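/- A one-way nondeterministic one-counter machine $M$ has a finite state set $Q$ with an initial state $q_0$ and a set $F$ of accepting states, a finite input alphabet $\Sigma$, a right end-marker $\lhd$, one counter holding a non-negative integer (initially $0$), and a transition relation $\delta$ from $Q\times(\Sigma\cup\{\lhd\})\times\{0,1\}$ to $Q\times\{\mathrm{S},\mathrm{R}\}\times\{-1,0,+1\}$: depending on the state, the symbol under the input head, and whether the counter is zero ($0$) or nonzero ($1$), it changes its state, lets the head stay ($\mathrm{S}$) or move right ($\mathrm{R}$), and adds $-1$, $0$ or $+1$ to the counter, where $-1$ is not allowed if the counter is zero. A word $w\in\Sigma^*$ is accepted if some computation that starts on $w\lhd$ in $q_0$, with the head on the first symbol, reaches a state of $F$ with the head on $\lhd$ (the counter content being arbitrary); $L(M)\subseteq\Sigma^*$ is the set of accepted words. The machine is $1$-reversal-bounded if, in every accepting computation, the counter alternates between increasing and decreasing at most once. $\mathrm{NCM}(1,1)$ is the class of the $1$-reversal-bounded machines of this kind, and also of the languages that they accept. A language $L\subseteq\Sigma^*$ is prefix-dense if $\mathrm{pref}(L)=\{w \mid wx\in L \text{ for some } x\in\Sigma^*\}$ equals $\Sigma^*$.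 **Corollary.** It is undecidable, given $L\in\mathrm{NCM}(1,1)$, whether $L$ is prefix-dense. That is, there is no algorithm that, for every given machine $M\in\mathrm{NCM}(1,1)$ with input alphabet $\Sigma$, halts and correctly answers whether $\mathrm{pref}(L(M))=\Sigma^*$. -/

import Mathlib

/-- `pref(L)`: the words `w` with `w x ∈ L` for some word `x`. -/
def prefixLang {α : Type*} (L : Language α) : Language α :=
  {w : List α | ∃ x : List α, w ++ x ∈ L}

/-- `L ⊆ Σ*` is prefix-dense if `pref(L) = Σ*`. -/
def PrefixDense {α : Type*} (L : Language α) : Prop :=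
  ∀ w : List α, w ∈ prefixLang L

/-- A transition `(tgt, move, change) ∈ δ(src, sym, positive)` of a one-way one-counter machine.
`sym = none` is the right end-marker; `positive = true` means that the counter is nonzero;
`moveRight = true` is the move `R` of the input head, `moveRight = false` is the move `S`. -/
structure CounterTransition where
  src : ℕ
  sym : Option ℕ
  positive : Bool
  tgt : ℕ
  moveRight : Bool
  change : ℤ

/-- The finite description of a one-way nondeterministic machine with one counter. The states are
`0, …, numStates - 1`, the input letters are `0, …, alphabetSize - 1`, and the transition relation
is given by the finite list of its elements (see `CounterMachine.WellFormed`). -/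
structure CounterMachine where
  numStates : ℕ
  alphabetSize : ℕ
  transitions : List CounterTransition
  start : ℕ
  finals : List ℕ

/-- Transitions as tuples. -/
def CounterTransition.equivTuple :
    CounterTransition ≃ ℕ × Option ℕ × Bool × ℕ × Bool × ℤ where
  toFun t := (t.src, t.sym, t.positive, t.tgt, t.moveRight, t.change)
  invFun t := ⟨t.1, t.2.1, t.2.2.1, t.2.2.2.1, t.2.2.2.2.1, t.2.2.2.2.2⟩
  left_inv _ := rfl
  right_inv _ := rfl

instance CounterTransition.instPrimcodable : Primcodable CounterTransition :=
  Primcodable.ofEquiv _ CounterTransition.equivTuple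

/-- Machines as tuples. -/
def CounterMachine.equivTuple :
    CounterMachine ≃ ℕ × ℕ × List CounterTransition × ℕ × List ℕ where
  toFun M := (M.numStates, M.alphabetSize, M.transitions, M.start, M.finals)
  invFun M := ⟨M.1, M.2.1, M.2.2.1, M.2.2.2.1, M.2.2.2.2⟩
  left_inv _ := rfl
  right_inv _ := rfl

instance CounterMachine.instPrimcodable : Primcodable CounterMachine :=
  Primcodable.ofEquiv _ CounterMachine.equivTuple

/-- A configuration: the state, the part of the input (with end-marker) that is still to be read,
and the content of the counter. -/
structure CounterConfig where
  state : ℕ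
  input : List (Option ℕ)
  counter : ℕ

namespace CounterMachine

/-- The description is a one-counter machine: states and letters are in range, the counter
changes by `-1`, `0` or `+1`, and it is not decremented when it is zero. -/
def WellFormed (M : CounterMachine) : Prop :=
  M.start < M.numStates ∧
  (∀ q ∈ M.finals, q < M.numStates) ∧
  ∀ t ∈ M.transitions,
    t.src < M.numStates ∧ t.tgt < M.numStates ∧
    (∀ a ∈ t.sym, a < M.alphabetSize) ∧
    (t.change = -1 ∨ t.change = 0 ∨ t.change = 1) ∧
    (t.positive = false → 0 ≤ t.change)

/-- One derivation step `C ⊢ C'` in which the counter changes by `d`. -/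
def Step (M : CounterMachine) (C : CounterConfig) (d : ℤ) (C' : CounterConfig) : Prop :=
  ∃ t ∈ M.transitions, ∃ w : List (Option ℕ),
    C.state = t.src ∧
    C.input = t.sym :: w ∧
    (t.positive = true ↔ C.counter ≠ 0) ∧
    C'.state = t.tgt ∧
    C'.input = (if t.moveRight then w else t.sym :: w) ∧
    (C'.counter : ℤ) = (C.counter : ℤ) + t.change ∧
    d = t.change

/-- `M.Run C ds C'`: a computation (finite sequence of derivation steps) leads from `C` to `C'`,
and the changes of the counter in its steps are, in this order, `ds`. -/
inductive Run (M : CounterMachine) : CounterConfig → List ℤ → CounterConfig → Prop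
  | refl (C : CounterConfig) : Run M C [] C
  | head {C C' C'' : CounterConfig} {d : ℤ} {ds : List ℤ} :
      M.Step C d C' → Run M C' ds C'' → Run M C (d :: ds) C''

/-- The input tape for the word `w`: its letters, followed by the end-marker. -/
def tape {n : ℕ} (w : List (Fin n)) : List (Option ℕ) :=
  w.map (fun a => some (a : ℕ)) ++ [none]

/-- There is an accepting computation on `w` in which the counter changes by `ds`: it starts in the
initial state, with the head on the first symbol and counter zero, and it ends in an accepting
state, with the head on the end-marker and any counter content. -/
def AcceptingRun (M : CounterMachine) (w : List (Fin M.alphabetSize)) (ds : List ℤ) : Prop :=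
  ∃ q ∈ M.finals, ∃ c : ℕ, M.Run ⟨M.start, tape w, 0⟩ ds ⟨q, [none], c⟩

/-- The language accepted by `M`, over its input alphabet. -/
def language (M : CounterMachine) : Language (Fin M.alphabetSize) :=
  {w : List (Fin M.alphabetSize) | ∃ ds : List ℤ, M.AcceptingRun w ds}

/-- The number of alternations between increasing and decreasing in a sequence of counter changes:
steps that leave the counter unchanged are ignored, and the number of maximal blocks of equal
changes is one more than the number of alternations (unless there is no change at all). -/
def reversals (ds : List ℤ) : ℕ :=
  ((ds.filter (fun d => d ≠ 0)).destutter (fun x y => x ≠ y)).length - 1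

/-- `M` is `l`-reversal-bounded: in every accepting computation, the counter alternates between
increasing and decreasing at most `l` times. -/
def ReversalBounded (M : CounterMachine) (l : ℕ) : Prop :=
  ∀ (w : List (Fin M.alphabetSize)) (ds : List ℤ), M.AcceptingRun w ds → reversals ds ≤ l

/-- `M` is a machine of the class `NCM(1, l)`: nondeterministic, one counter,
`l`-reversal-bounded. -/
def IsNCMOne (l : ℕ) (M : CounterMachine) : Prop :=
  M.WellFormed ∧ M.ReversalBounded l

end CounterMachine

/-- The problem "given an instance `a` that satisfies `inst`, does `p a` hold?" is decidable: some
algorithm (a partial recursive function) halts with the correct answer on every `a` with `inst a`.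
Nothing is required of it on other inputs. -/
def DecidableOn {α : Type*} [Primcodable α] (inst p : α → Prop) : Prop :=
  ∃ f : α →. Bool, Partrec f ∧
    ∀ a, inst a → (p a → true ∈ f a) ∧ (¬ p a → false ∈ f a)

/-! The halting problem is reduced to the failure of prefix-density, through a form of Post's
correspondence problem.

A domino problem consists of finitely many dominoes and a word `p`; a solution is a sequence `α` of
dominoes whose upper row equals `p` followed by its lower row. The counter machine accepts `α 0 z`
when `z` differs at some position from one of the two rows of `α`, each closed by the separator `0`.
It guesses the row and the position, counts the letters of the row up to this position while it
reads `α`, and counts down again in `z`: one reversal suffices.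

If `α` is a solution with common row `u`, then no extension of `α 0 u 0` is accepted, since every
position of the closed rows is already filled correctly. If there is no solution, any word can be
extended so that it contains a separator, which fixes `α`. The two closed rows differ at some `j`,
and once `z` is longer than `j`, its letter there disagrees with one of them. This is
`prefixDense_mismatchMachine_iff`; it rests on `mem_mismatchMachine_language`.

Domino problems encode halting. The upper row lags one word of a derivation behind the lower row, so
a solution spells out a derivation from the initial word to the word `halt`; the semi-Thue system
simulates a Turing machine. Since one fixed universal machine is used (`exists_universal_machine`),
the dominoes are fixed and only `p` depends on the instance. Computability of the reduction thus
concerns `p` alone. -/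

/-! ### Semi-Thue systems and dominoes -/

section Rewriting

variable {α : Type*}

/-- One rewriting step of the semi-Thue system with the rules `R`. -/
def Rewrites (R : List α → List α → Prop) (w w' : List α) : Prop :=
  ∃ x l r y, R l r ∧ w = x ++ l ++ y ∧ w' = x ++ r ++ y

/-- The dominoes of a semi-Thue system: its rules, copies of letters, and one domino that erases
the word `halt`, followed by the separator `hash`. -/
def IsDomino (R : List α → List α → Prop) (halt hash : α) (d : List α × List α) : Prop :=
  R d.1 d.2 ∨ (∃ a, d = ([a], [a])) ∨ d = ([halt, hash], [])

variable {R : List α → List α → Prop} {halt hash : α}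

/-- A domino whose upper word avoids the separator cannot reach across it, so it consumes only
letters of the current word. -/
theorem eq_append_of_append_eq_append_cons {l x c y : List α} (hl : hash ∉ l)
    (h : l ++ x = c ++ hash :: y) : ∃ c', c = l ++ c' ∧ x = c' ++ hash :: y := by
  rcases List.append_eq_append_iff.1 h with ⟨c', hc, hx⟩ | ⟨l', hl', hy⟩
  · exact ⟨c', hc, hx⟩
  · cases l' with
    | nil => exact ⟨[], by simpa using hl'.symm, by simpa using hy.symm⟩
    | cons a l' =>
      simp only [List.cons_append, List.cons.injEq] at hy
      exact absurd (by rw [hl', ← hy.1]; simp) hl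

/-- In a domino solution, the lower row continues a derivation from `w`; here `y` is the part of
the current word that is already rewritten and `c` the part that is still to be copied. -/
theorem exists_derivation_of_dominoes (hR : ∀ l r, R l r → hash ∉ l ∧ hash ∉ r)
    (hne : halt ≠ hash) {w : List α} (ds : List (List α × List α))
    (hds : ∀ d ∈ ds, IsDomino R halt hash d) :
    ∀ c y : List α, hash ∉ c → hash ∉ y → Relation.ReflTransGen (Rewrites R) w (y ++ c) →
      ds.flatMap Prod.fst = c ++ hash :: (y ++ ds.flatMap Prod.snd) →
      ∃ w', Relation.ReflTransGen (Rewrites R) w w' ∧ halt ∈ w' := by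
  induction ds with
  | nil => intro c y _ _ _ h; simp at h
  | cons d ds ih =>
    intro c y hc hy hw h
    have hds' : ∀ d ∈ ds, IsDomino R halt hash d := fun d hd => hds d (by simp [hd])
    obtain ⟨l, r⟩ := d
    simp only [List.flatMap_cons] at h
    -- Rules and copies of ordinary letters move `l` off the front of `c` and put `r` at the end of
    -- `y`. The represented word is rewritten once or stays the same.
    have hrule : ∀ (_ : hash ∉ l) (_ : hash ∉ r) (_ : R l r ∨ l = r),
        ∃ w', Relation.ReflTransGen (Rewrites R) w w' ∧ halt ∈ w' := by
      intro hl hr hlr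
      obtain ⟨c', rfl, hx⟩ := eq_append_of_append_eq_append_cons hl h
      refine ih hds' c' (y ++ r) (by simp_all) (by simp_all) ?_ (by simp [hx])
      rcases hlr with hlr | rfl
      · exact hw.tail ⟨y, l, r, c', hlr, by simp, by simp⟩
      · simpa using hw
    rcases hds (l, r) (by simp) with hlr | ⟨a, ha⟩ | hlr
    · exact hrule (hR l r hlr).1 (hR l r hlr).2 (.inl hlr)
    · simp only [Prod.mk.injEq] at ha
      obtain ⟨rfl, rfl⟩ := ha
      -- Copying the separator is possible only when `c` is used up; then `y` becomes the word to be
      -- copied.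
      by_cases ha : a = hash
      · subst ha
        cases c with
        | nil =>
          refine ih hds' y [] hy (by simp) (by simpa using hw) ?_
          simpa using h
        | cons b c => simp_all
      · exact hrule (by simpa using fun h => ha h.symm) (by simpa using fun h => ha h.symm)
          (.inr rfl)
    -- The erasing domino shows `halt` as the first letter of `c`; an empty `c` would force `halt =
    -- hash`.
    · simp only [Prod.mk.injEq] at hlr
      obtain ⟨rfl, rfl⟩ := hlr
      cases c with
      | nil => simp_all
      | cons b c =>
        simp only [List.cons_append, List.cons.injEq] at h
        exact ⟨_, hw, by simp [h.1]⟩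

theorem flatMap_copies_fst (x : List α) :
    (x.map fun a => (([a], [a]) : List α × List α)).flatMap Prod.fst = x := by
  induction x <;> simp_all

theorem flatMap_copies_snd (x : List α) :
    (x.map fun a => (([a], [a]) : List α × List α)).flatMap Prod.snd = x := by
  induction x <;> simp_all

/-- By induction from the front of the derivation: a step `x l y → x r y` is spelled by copies of
`x`, the rule, copies of `y` and a copied separator. The final word `[halt]` is spelled by the
erasing domino, whose empty lower word ends the lag. -/
theorem exists_dominoes_of_derivation {w : List α}
    (h : Relation.ReflTransGen (Rewrites R) w [halt]) :
    ∃ ds : List (List α × List α), (∀ d ∈ ds, IsDomino R halt hash d) ∧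
      ds.flatMap Prod.fst = w ++ hash :: ds.flatMap Prod.snd := by
  induction h using Relation.ReflTransGen.head_induction_on with
  | refl => exact ⟨[([halt, hash], [])], by simp [IsDomino], by simp⟩
  | head h _ ih =>
    obtain ⟨x, l, r, y, hlr, rfl, rfl⟩ := h
    obtain ⟨ds, hds, e⟩ := ih
    refine ⟨x.map (fun a => ([a], [a])) ++ (l, r) :: (y.map (fun a => ([a], [a])) ++
      ([hash], [hash]) :: ds), ?_, ?_⟩
    · intro d hd
      simp only [List.mem_append, List.mem_map, List.mem_cons] at hd
      rcases hd with ⟨a, -, rfl⟩ | rfl | ⟨a, -, rfl⟩ | rfl | hd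
      · exact .inr (.inl ⟨a, rfl⟩)
      · exact .inl hlr
      · exact .inr (.inl ⟨a, rfl⟩)
      · exact .inr (.inl ⟨hash, rfl⟩)
      · exact hds d hd
    · simp only [List.flatMap_append, List.flatMap_cons, flatMap_copies_fst, flatMap_copies_snd, e]
      simp

end Rewriting

/-! ### Turing machines as semi-Thue systems -/

section TuringRewriting

open Turing StateTransition

/-- The letters of the words that describe configurations of a Turing machine. -/
inductive TMSym (Γ Λ : Type*)
  | tape (a : Γ)
  | state (q : Λ)
  | leftEnd
  | rightEnd
  | halt
  | hash

instance TMSym.instFinite {Γ Λ : Type*} [Finite Γ] [Finite Λ] : Finite (TMSym Γ Λ) := by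
  let f : TMSym Γ Λ → Γ ⊕ Λ ⊕ Fin 4 := fun s => match s with
    | .tape a => .inl a
    | .state q => .inr (.inl q)
    | .leftEnd => .inr (.inr 0)
    | .rightEnd => .inr (.inr 1)
    | .halt => .inr (.inr 2)
    | .hash => .inr (.inr 3)
  refine Finite.of_injective f ?_
  intro s t h
  cases s <;> cases t <;> simp_all [f]

variable {Γ Λ : Type*}

/-- The word for the configuration with the state `q`, the symbols `l` to the left of the head and
the symbols `r` from the head on. -/
def tmWord (q : Λ) (l r : List Γ) : List (TMSym Γ Λ) :=
  (.leftEnd :: l.map .tape) ++ .state q :: (r.map .tape ++ [.rightEnd])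

/-- A configuration word contains exactly one state letter, so a rule that involves a state applies
only at the head. -/
theorem tmWord_eq_append_state {q q' : Λ} {l r : List Γ} {x y : List (TMSym Γ Λ)}
    (h : tmWord q l r = x ++ .state q' :: y) :
    x = .leftEnd :: l.map .tape ∧ q' = q ∧ y = r.map .tape ++ [.rightEnd] := by
  rw [tmWord, List.append_cons_inj_of_notMem (by simp) (by simp)] at h
  simp_all

theorem exists_eq_cons_of_tape_cons {a : Γ} {r : List Γ} {y : List (TMSym Γ Λ)}
    (h : .tape a :: y = r.map .tape ++ [.rightEnd]) :
    ∃ r', r = a :: r' ∧ y = r'.map .tape ++ [.rightEnd] := by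
  cases r with
  | nil => simp at h
  | cons b r => simp_all

variable [Inhabited Γ]

/-- The configuration described by `tmWord q l r`. -/
def tmCfg (q : Λ) (l r : List Γ) : TM0.Cfg Γ Λ :=
  ⟨q, Tape.mk' (ListBlank.mk l.reverse) (ListBlank.mk r)⟩

theorem ListBlank_mk_append_default (l : List Γ) :
    ListBlank.mk (l ++ [default]) = ListBlank.mk l := by
  refine Quotient.sound' (.inr ⟨1, by simp⟩)

/-- `l` is written from left to right, so a blank at its front is a trailing blank of the reversed
half-tape and does not count. -/
theorem tmCfg_padLeft (q : Λ) (l r : List Γ) : tmCfg q (default :: l) r = tmCfg q l r := by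
  simp [tmCfg, ListBlank_mk_append_default]

theorem tmCfg_padRight (q : Λ) (l r : List Γ) : tmCfg q l (r ++ [default]) = tmCfg q l r := by
  simp [tmCfg, ListBlank_mk_append_default]

variable [Inhabited Λ]

/-- The rewriting rules that simulate a Turing machine. -/
inductive TMRule (M : TM0.Machine Γ Λ) : List (TMSym Γ Λ) → List (TMSym Γ Λ) → Prop
  | padLeft : TMRule M [.leftEnd] [.leftEnd, .tape default]
  | padRight : TMRule M [.rightEnd] [.tape default, .rightEnd]
  | write {q a q' b} : M q a = some (q', .write b) →
      TMRule M [.state q, .tape a] [.state q', .tape b]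
  | right {q a q'} : M q a = some (q', .move .right) →
      TMRule M [.state q, .tape a] [.tape a, .state q']
  | left {q a q' b} : M q a = some (q', .move .left) →
      TMRule M [.tape b, .state q, .tape a] [.state q', .tape b, .tape a]
  | halt {q a} : M q a = none → TMRule M [.state q, .tape a] [.halt]
  | eraseLeft {x} : x ≠ .hash → TMRule M [x, .halt] [.halt]
  | eraseRight {x} : x ≠ .hash → TMRule M [.halt, x] [.halt]

theorem TMRule.hash_notMem {M : TM0.Machine Γ Λ} {l r : List (TMSym Γ Λ)} (h : TMRule M l r) :
    .hash ∉ l ∧ .hash ∉ r := by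
  cases h <;> simp_all [eq_comm]

/-- This bound makes the set of dominoes finite. -/
theorem TMRule.length_le {M : TM0.Machine Γ Λ} {l r : List (TMSym Γ Λ)} (h : TMRule M l r) :
    l.length ≤ 3 ∧ r.length ≤ 3 := by
  cases h <;> simp

theorem tmCfg_init (l : List Γ) : (tmCfg default [] l : TM0.Cfg Γ Λ) = TM0.init l := rfl

section Steps

variable {M : TM0.Machine Γ Λ} {q q' : Λ} {a b : Γ} {l r : List Γ}

theorem step_tmCfg_write (h : M q a = some (q', .write b)) :
    TM0.step M (tmCfg q l (a :: r)) = some (tmCfg q' l (b :: r)) := by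
  simp [tmCfg, TM0.step, h, ← ListBlank.cons_mk, Tape.write_mk']

theorem step_tmCfg_right (h : M q a = some (q', .move .right)) :
    TM0.step M (tmCfg q l (a :: r)) = some (tmCfg q' (l ++ [a]) r) := by
  simp [tmCfg, TM0.step, h, ← ListBlank.cons_mk, Tape.move_right_mk']

theorem step_tmCfg_left (h : M q a = some (q', .move .left)) :
    TM0.step M (tmCfg q (l ++ [b]) (a :: r)) = some (tmCfg q' l (b :: a :: r)) := by
  simp [tmCfg, TM0.step, h, ← ListBlank.cons_mk, Tape.move_left_mk']

theorem step_tmCfg_halt (h : M q a = none) :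
    TM0.step M (tmCfg q l (a :: r)) = none := by
  simp [tmCfg, TM0.step, h, ← ListBlank.cons_mk]

end Steps

/-! ### From derivations to halting computations -/

/-- A word that is derivable from the initial word describes a reachable configuration, unless the
machine halts. -/
theorem tmWord_of_rewrites {M : TM0.Machine Γ Λ} {c : TM0.Cfg Γ Λ} {q : Λ} {l r : List Γ}
    {w : List (TMSym Γ Λ)} (hc : Reaches (TM0.step M) c (tmCfg q l r))
    (h : Rewrites (TMRule M) (tmWord q l r) w) :
    (eval (TM0.step M) c).Dom ∨
      ∃ q' l' r', w = tmWord q' l' r' ∧ Reaches (TM0.step M) c (tmCfg q' l' r') := by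
  obtain ⟨x, u, v, y, hR, e, rfl⟩ := h
  have hhalt : TMSym.halt ∉ tmWord q l r := by simp [tmWord]
  cases hR with
  | padLeft =>
    right
    have e' : [] ++ TMSym.leftEnd :: (l.map .tape ++ .state q :: (r.map .tape ++ [.rightEnd])) =
      x ++ .leftEnd :: y := by simpa [tmWord] using e
    rw [List.append_cons_inj_of_notMem (by simp) (by simp)] at e'
    obtain ⟨rfl, -, rfl⟩ := e'
    exact ⟨q, default :: l, r, by simp [tmWord], by rwa [tmCfg_padLeft]⟩
  | padRight =>
    right
    have e' : (TMSym.leftEnd :: l.map .tape ++ .state q :: r.map .tape) ++ .rightEnd :: [] =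
      x ++ .rightEnd :: y := by simpa [tmWord] using e
    rw [List.append_cons_inj_of_notMem (by simp) (by simp)] at e'
    obtain ⟨rfl, -, rfl⟩ := e'
    exact ⟨q, l, r ++ [default], by simp [tmWord], by rwa [tmCfg_padRight]⟩
  | write hM =>
    right
    obtain ⟨rfl, rfl, hy⟩ := tmWord_eq_append_state (e.trans (by simp; rfl))
    obtain ⟨r, rfl, rfl⟩ := exists_eq_cons_of_tape_cons hy
    exact ⟨_, l, _ :: r, by simp [tmWord], hc.tail (step_tmCfg_write hM)⟩
  | right hM =>
    right
    obtain ⟨rfl, rfl, hy⟩ := tmWord_eq_append_state (e.trans (by simp; rfl))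
    obtain ⟨r, rfl, rfl⟩ := exists_eq_cons_of_tape_cons hy
    exact ⟨_, l ++ [_], r, by simp [tmWord], hc.tail (step_tmCfg_right hM)⟩
  | @left q₁ a q' b hM =>
    right
    obtain ⟨hx, rfl, hy⟩ := tmWord_eq_append_state (x := x ++ [.tape b]) (q' := q₁)
      (y := .tape a :: y) (e.trans (by simp))
    obtain ⟨r, rfl, rfl⟩ := exists_eq_cons_of_tape_cons hy
    -- With nothing to the left, the letter before the state would be `leftEnd`, which is not a tape
    -- letter.
    rcases List.eq_nil_or_concat l with rfl | ⟨l, b', rfl⟩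
    · have := congrArg List.getLast? hx
      simp at this
    · have hx' : x ++ [.tape b] = (.leftEnd :: l.map .tape) ++ [.tape b'] := by simpa using hx
      obtain ⟨rfl, hb⟩ := List.append_inj' hx' rfl
      obtain rfl : b = b' := by simpa using hb
      rw [List.concat_eq_append] at hc
      exact ⟨_, l, b :: _ :: r, by simp [tmWord], hc.tail (step_tmCfg_left hM)⟩
  | halt hM =>
    left
    obtain ⟨rfl, rfl, hy⟩ := tmWord_eq_append_state (e.trans (by simp; rfl))
    obtain ⟨r, rfl, rfl⟩ := exists_eq_cons_of_tape_cons hy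
    exact Part.dom_iff_mem.2 ⟨_, mem_eval.2 ⟨hc, step_tmCfg_halt hM⟩⟩
  | eraseLeft => exact absurd (by rw [e]; simp) hhalt
  | eraseRight => exact absurd (by rw [e]; simp) hhalt

/-- As long as no halting is detected, all derived words are configuration words, and these do not
contain `halt`. -/
theorem dom_of_rewrites_halt {M : TM0.Machine Γ Λ} {l : List Γ} {w : List (TMSym Γ Λ)}
    (h : Relation.ReflTransGen (Rewrites (TMRule M)) (tmWord default [] l) w) (hw : .halt ∈ w) :
    (eval (TM0.step M) (TM0.init l)).Dom := by
  have key : (eval (TM0.step M) (TM0.init l)).Dom ∨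
      ∃ q' l' r', w = tmWord q' l' r' ∧
        Reaches (TM0.step M) (TM0.init l) (tmCfg q' l' r') := by
    clear hw
    induction h with
    | refl => exact .inr ⟨_, _, _, rfl, .refl⟩
    | tail _ h ih =>
      rcases ih with ih | ⟨q, l, r, rfl, ih⟩
      · exact .inl ih
      · exact tmWord_of_rewrites ih h
  rcases key with h | ⟨q, l, r, rfl, -⟩
  · exact h
  · simp [tmWord] at hw

/-! ### From halting computations to derivations -/

section Completeness

variable {M : TM0.Machine Γ Λ}

theorem rewrites_erase_left (x y : List (TMSym Γ Λ)) (hx : .hash ∉ x) :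
    Relation.ReflTransGen (Rewrites (TMRule M)) (x ++ .halt :: y) (.halt :: y) := by
  induction x using List.reverseRecOn with
  | nil => exact .refl
  | append_singleton x a ih =>
    refine .head ⟨x, [a, .halt], [.halt], y, .eraseLeft ?_, by simp, rfl⟩ ?_
    · rintro rfl; simp at hx
    · simpa using ih (by simp_all)

theorem rewrites_erase_right (y : List (TMSym Γ Λ)) (hy : .hash ∉ y) :
    Relation.ReflTransGen (Rewrites (TMRule M)) (.halt :: y) [.halt] := by
  induction y with
  | nil => exact .refl
  | cons a y ih =>
    refine .head ⟨[], [.halt, a], [.halt], y, .eraseRight ?_, by simp, rfl⟩ ?_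
    · rintro rfl; simp at hy
    · simpa using ih (by simp_all)

theorem rewrites_padRight (q : Λ) (l : List Γ) :
    Rewrites (TMRule M) (tmWord q l []) (tmWord q l [default]) :=
  ⟨.leftEnd :: l.map .tape ++ [.state q], _, _, [], .padRight, by simp [tmWord], by simp [tmWord]⟩

theorem rewrites_padLeft (q : Λ) (r : List Γ) :
    Rewrites (TMRule M) (tmWord q [] r) (tmWord q [default] r) :=
  ⟨[], _, _, _, .padLeft, by simp [tmWord]; rfl, by simp [tmWord]⟩

theorem exists_rewrites_cons (q : Λ) (l r : List Γ) : ∃ a r',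
    tmCfg q l (a :: r') = tmCfg q l r ∧
      Relation.ReflTransGen (Rewrites (TMRule M)) (tmWord q l r) (tmWord q l (a :: r')) := by
  cases r with
  | nil => exact ⟨default, [], tmCfg_padRight q l [], .single (rewrites_padRight q l)⟩
  | cons a r => exact ⟨a, r, rfl, .refl⟩

theorem exists_rewrites_concat (q : Λ) (l r : List Γ) : ∃ l' b,
    tmCfg q (l' ++ [b]) r = tmCfg q l r ∧
      Relation.ReflTransGen (Rewrites (TMRule M)) (tmWord q l r) (tmWord q (l' ++ [b]) r) := by
  rcases List.eq_nil_or_concat l with rfl | ⟨l, b, rfl⟩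
  · exact ⟨[], default, tmCfg_padLeft q [] r, .single (rewrites_padLeft q r)⟩
  · exact ⟨l, b, by simp, by rw [List.concat_eq_append]⟩

/-- Padding by blanks first makes the scanned letter, and for a left move also its left neighbour,
explicit in the word; then one rule performs the step. -/
theorem rewrites_of_step {q : Λ} {l r : List Γ} {c : TM0.Cfg Γ Λ}
    (h : TM0.step M (tmCfg q l r) = some c) : ∃ q' l' r', c = tmCfg q' l' r' ∧
      Relation.ReflTransGen (Rewrites (TMRule M)) (tmWord q l r) (tmWord q' l' r') := by
  obtain ⟨a, r, hcfg, hw⟩ := exists_rewrites_cons (M := M) q l r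
  rw [← hcfg] at h
  rcases hM : M q a with _ | ⟨q', d | b⟩
  · rw [step_tmCfg_halt hM] at h
    cases h
  · cases d with
    | left =>
      obtain ⟨l, b, hcfg', hw'⟩ := exists_rewrites_concat (M := M) q l (a :: r)
      rw [← hcfg', step_tmCfg_left hM, Option.some.injEq] at h
      refine ⟨q', _, _, h.symm, (hw.trans hw').tail
        ⟨.leftEnd :: l.map .tape, _, _, r.map .tape ++ [.rightEnd], .left (b := b) hM, ?_, ?_⟩⟩ <;>
      simp [tmWord]
    | right =>
      rw [step_tmCfg_right hM, Option.some.injEq] at h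
      refine ⟨q', _, _, h.symm, hw.tail
        ⟨.leftEnd :: l.map .tape, _, _, r.map .tape ++ [.rightEnd], .right hM, ?_, ?_⟩⟩ <;>
      simp [tmWord]
  · rw [step_tmCfg_write hM, Option.some.injEq] at h
    refine ⟨q', _, _, h.symm, hw.tail
      ⟨.leftEnd :: l.map .tape, _, _, r.map .tape ++ [.rightEnd], .write hM, ?_, ?_⟩⟩ <;>
    simp [tmWord]

theorem rewrites_halt_of_dom {l : List Γ} (h : (eval (TM0.step M) (TM0.init l)).Dom) :
    Relation.ReflTransGen (Rewrites (TMRule M)) (tmWord default [] l) [.halt] := by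
  obtain ⟨c, hc⟩ := Part.dom_iff_mem.1 h
  obtain ⟨hreach, hstep⟩ := mem_eval.1 hc
  have key : ∃ q' l' r', c = tmCfg q' l' r' ∧ Relation.ReflTransGen (Rewrites (TMRule M))
      (tmWord default [] l) (tmWord q' l' r') := by
    clear hc hstep
    induction hreach with
    | refl => exact ⟨_, _, _, (tmCfg_init l).symm, .refl⟩
    | tail _ h ih =>
      obtain ⟨q, l, r, rfl, ih⟩ := ih
      obtain ⟨q', l', r', rfl, ih'⟩ := rewrites_of_step h
      exact ⟨q', l', r', rfl, ih.trans ih'⟩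
  obtain ⟨q, l, r, rfl, hw⟩ := key
  obtain ⟨a, r, hcfg, hw'⟩ := exists_rewrites_cons (M := M) q l r
  rw [← hcfg] at hstep
  have hM : M q a = none := by
    simpa [tmCfg, TM0.step, ← ListBlank.cons_mk] using hstep
  refine ((hw.trans hw').tail
    ⟨.leftEnd :: l.map .tape, _, _, r.map .tape ++ [.rightEnd], .halt hM, ?_, rfl⟩).trans ?_
  · simp [tmWord]
  · rw [List.append_assoc]
    exact (rewrites_erase_left _ _ (by simp)).trans (rewrites_erase_right _ (by simp))

end Completeness

end TuringRewriting

/-! ### A Turing machine with an undecidable halting problem -/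

section UniversalMachine

open Turing StateTransition

/-- A Post-Turing machine that uses finitely many states is simulated by one whose type of states
is finite. -/
theorem exists_finite_states {Γ Λ : Type} [Inhabited Γ] [Inhabited Λ] (M : TM0.Machine Γ Λ)
    (S : Finset Λ) (hS : TM0.Supports M S) :
    ∃ (Λ' : Type) (_ : Inhabited Λ') (_ : Finite Λ') (M' : TM0.Machine Γ Λ'), ∀ l : List Γ,
      (eval (TM0.step M') (TM0.init l)).Dom ↔ (eval (TM0.step M) (TM0.init l)).Dom := by
  classical
  let : Inhabited S := ⟨⟨default, hS.1⟩⟩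
  let f : PointedMap Γ Γ := ⟨id, rfl⟩
  let g : Λ → S := fun q => if h : q ∈ S then ⟨q, h⟩ else default
  have hg : g default = default := by
    simp only [g, Finset.mem_coe.1 hS.1, dif_pos]
    rfl
  refine ⟨S, inferInstance, inferInstance, M.map f f g Subtype.val, fun l => ?_⟩
  refine tr_eval_dom (TM0.Machine.map_respects M f f ⟨g, hg⟩ Subtype.val hS (fun _ => rfl) ?_)
    ⟨hS.1, ?_⟩
  · intro q hq
    simp [g, Finset.mem_coe.1 hq]
  · rw [TM0.map_init]
    exact congrArg TM0.init (List.map_id l)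

/-- Rewritten through `Nat.bits`, the input word of the universal machine can be shown to be
primitive recursive in `n`. -/
theorem trNat_eq_bits (n : ℕ) :
    PartrecToTM2.trNat n =
      n.bits.map fun b => cond b PartrecToTM2.Γ'.bit1 PartrecToTM2.Γ'.bit0 := by
  have key : ∀ p : PosNum, PartrecToTM2.trPosNum p =
      (p : ℕ).bits.map fun b => cond b PartrecToTM2.Γ'.bit1 PartrecToTM2.Γ'.bit0 := by
    intro p
    induction p with
    | one => simp [PartrecToTM2.trPosNum]
    | bit0 p ih =>
      rw [PosNum.cast_bit0, ← two_mul, Nat.bit0_bits _ (PosNum.cast_pos p).ne']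
      simp [PartrecToTM2.trPosNum, ih]
    | bit1 p ih =>
      rw [PosNum.cast_bit1, ← two_mul, Nat.bit1_bits]
      simp [PartrecToTM2.trPosNum, ih]
  rw [PartrecToTM2.trNat]
  obtain ⟨m, rfl⟩ : ∃ m : Num, n = m := ⟨(n : Num), by simp⟩
  cases m with
  | zero => simp [PartrecToTM2.trNum]
  | pos p => simpa [PartrecToTM2.trNum] using key p

theorem primrec_bits : Primrec Nat.bits := by
  -- In this course-of-values recursion `l` lists the bits of `0, …, n - 1`, so its length is `n`,
  -- and its entry at `div2 n` supplies the tail.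
  let step : Unit → List (List Bool) → Option (List Bool) := fun _ l =>
    bif l.length == 0 then some []
    else some ((l.length).bodd :: (l[(l.length).div2]?).getD [])
  have hstep : Primrec₂ step := by
    have hlen : Primrec fun p : Unit × List (List Bool) => p.2.length :=
      Primrec.list_length.comp Primrec.snd
    refine Primrec.cond ((Primrec.beq).comp hlen (Primrec.const 0)) (Primrec.const _) ?_
    refine Primrec.option_some.comp (Primrec.list_cons.comp (Primrec.nat_bodd.comp hlen) ?_)
    exact Primrec.option_getD.comp
      (Primrec.list_getElem?.comp Primrec.snd (Primrec.nat_div2.comp hlen)) (Primrec.const [])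
  have := Primrec.nat_strong_rec (fun (_ : Unit) n => Nat.bits n) hstep ?_
  · exact this.comp (Primrec.const ()) Primrec.id
  · intro _ n
    rcases n.eq_zero_or_pos with rfl | hn
    · simp [step]
    · have hlt : n.div2 < n := by rw [Nat.div2_val]; omega
      have hbits : n.bits = n.bodd :: n.div2.bits := by
        conv_lhs => rw [← Nat.bit_bodd_div2 n]
        refine Nat.bits_append_bit _ _ fun h => ?_
        by_contra hb
        have := Nat.bit_bodd_div2 n
        simp_all
      have : (n == 0) = false := by simp; omega
      simp [step, this, hbits, hlt]

theorem finite_stackNames : Finite PartrecToTM2.K' := by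
  refine Finite.of_surjective
    (![.main, .rev, .aux, .stack] : Fin 4 → PartrecToTM2.K') fun k => ?_
  cases k
  exacts [⟨0, rfl⟩, ⟨1, rfl⟩, ⟨2, rfl⟩, ⟨3, rfl⟩]

/-- There is a Turing machine whose halting problem is undecidable: it halts on the `n`-th input
if and only if the `n`-th program halts on `0`. -/
theorem exists_universal_machine :
    ∃ (Γ Λ : Type) (_ : Inhabited Γ) (_ : Inhabited Λ) (_ : Finite Γ) (_ : Finite Λ)
      (M : TM0.Machine Γ Λ) (inp : ℕ → List Γ),
      (∀ e : Γ → ℕ, Primrec fun n => (inp n).map e) ∧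
      ∀ n, (eval (TM0.step M) (TM0.init (inp n))).Dom ↔
        (Nat.Partrec.Code.eval (Denumerable.ofNat Nat.Partrec.Code n) 0).Dom := by
  have hpart : Partrec fun v : List.Vector ℕ 1 =>
      Nat.Partrec.Code.eval (Denumerable.ofNat Nat.Partrec.Code v.head) 0 :=
    Nat.Partrec.Code.eval_part.comp
      ((Computable.ofNat Nat.Partrec.Code).comp Primrec.vector_head.to_comp) (Computable.const 0)
  obtain ⟨c, hc⟩ := ToPartrec.Code.exists_code (Nat.Partrec'.of_part hpart)
  -- Machines start in the default state, so this instance selects the program `c`.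
  let : Inhabited PartrecToTM2.Λ' := ⟨PartrecToTM2.trNormal c PartrecToTM2.Cont'.halt⟩
  let M₂ : PartrecToTM2.Λ' → PartrecToTM2.Stmt' := PartrecToTM2.tr
  let M₁ := TM2to1.tr M₂
  let M₀ := TM1to0.tr M₁
  obtain ⟨Λ, hΛ, hfin, M, hM⟩ := exists_finite_states M₀ _
    (TM1to0.tr_supports M₁ (TM2to1.tr_supports M₂ (PartrecToTM2.tr_supports c .halt)))
  let inp : ℕ → List (TM2to1.Γ' PartrecToTM2.K' fun _ => PartrecToTM2.Γ') := fun n =>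
    TM2to1.trInit PartrecToTM2.K'.main (PartrecToTM2.trList [n])
  have hK := finite_stackNames
  have hΓ : Finite (TM2to1.Γ' PartrecToTM2.K' fun _ => PartrecToTM2.Γ') :=
    inferInstanceAs (Finite (Bool × (PartrecToTM2.K' → Option PartrecToTM2.Γ')))
  refine ⟨_, Λ, inferInstance, hΛ, hΓ, hfin, M, inp, ?_, fun n => ?_⟩
  · intro e
    let s : PartrecToTM2.Γ' → TM2to1.Γ' PartrecToTM2.K' fun _ => PartrecToTM2.Γ' :=
      fun a => (false, Function.update (fun _ => none) PartrecToTM2.K'.main (some a))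
    -- The stack is laid out from its bottom letter `cons`, whose cell carries the bottom mark
    -- `true`.
    have hinp : ∀ n, (inp n).map e = e (true, (s .cons).2) ::
        n.bits.reverse.map fun b => e (s (cond b .bit1 .bit0)) := by
      intro n
      have hrev : (PartrecToTM2.trList [n]).reverse = .cons :: n.bits.reverse.map
          fun b => cond b PartrecToTM2.Γ'.bit1 PartrecToTM2.Γ'.bit0 := by
        simp [PartrecToTM2.trList, trNat_eq_bits]
      simp only [inp, TM2to1.trInit, hrev]
      change e (true, (s .cons).2) :: ((n.bits.reverse.map _).map s).map e = _
      rw [List.map_map, List.map_map]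
      rfl
    refine Primrec.of_eq ?_ fun n => (hinp n).symm
    refine Primrec.list_cons.comp (Primrec.const _)
      (Primrec.list_map (Primrec.list_reverse.comp primrec_bits) ?_)
    exact (Primrec.dom_finite fun b : Bool => e (s (cond b .bit1 .bit0))).comp Primrec.snd
  · rw [hM]
    have h₀ := congrArg Part.Dom (TM1to0.tr_eval M₁ (inp n))
    have h₁ := TM2to1.tr_eval_dom M₂ PartrecToTM2.K'.main (PartrecToTM2.trList [n])
    have h₂ := congrArg Part.Dom (PartrecToTM2.tr_eval c [n])
    have hcn : ToPartrec.Code.eval c [n] = _ := hc (n ::ᵥ List.Vector.nil)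
    have hinit : (TM2.init PartrecToTM2.K'.main (PartrecToTM2.trList [n]) : PartrecToTM2.Cfg') =
        PartrecToTM2.init c [n] := by
      simp only [TM2.init, PartrecToTM2.init]
      congr 1
      funext k
      cases k <;> rfl
    rw [hcn] at h₂
    have h₃ : (TM2.eval M₂ PartrecToTM2.K'.main (PartrecToTM2.trList [n])).Dom ↔
        (eval (TM2.step PartrecToTM2.tr) (PartrecToTM2.init c [n])).Dom := by
      rw [← hinit]
      rfl
    exact (iff_of_eq h₀).trans (h₁.trans (h₃.trans (iff_of_eq h₂)))

end UniversalMachine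

/-! ### The counter machine of a domino problem

Letters are natural numbers below `k`; the letter `0` is a separator. Each nonzero letter `a` stands
for a domino with the rows `h false a` and `h true a`, and the lower row starts with the word `p`.
The machine accepts the words `α 0 z` such that `z` differs at some position from one of the two
rows of the sequence `α` of dominoes. -/

section MismatchMachine

/-- The `i`-th row of the sequence `α` of dominoes, followed by the separator. -/
def dominoRow (h : Bool → ℕ → List ℕ) (p : List ℕ) (i : Bool) (α : List ℕ) : List ℕ :=
  (bif i then p else []) ++ α.flatMap (h i) ++ [0]

/-- The states of the machine: `emit i w` counts letters of the `i`-th row, and the next letters are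
those of `w`; in `chosen b` a position with the letter `b` has been chosen, and the machine goes to
the separator; in `seek b` it goes to this position in the second part of the input. -/
inductive MismatchState
  | start
  | emit (i : Bool) (w : List ℕ)
  | chosen (b : ℕ)
  | seek (b : ℕ)
  | accept

namespace MismatchState

/-- The states as natural numbers. -/
def code : MismatchState → ℕ
  | start => Nat.pair 0 0
  | emit i w => Nat.pair 1 (Encodable.encode (i, w))
  | chosen b => Nat.pair 2 b
  | seek b => Nat.pair 3 b
  | accept => Nat.pair 4 0

theorem code_injective : Function.Injective code := by
  intro s t h
  cases s <;> cases t <;> simp_all [code, Nat.pair_eq_pair]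

/-- The states in which the counter does not increase any more. -/
def Late : MismatchState → Prop
  | seek _ => True
  | accept => True
  | _ => False

end MismatchState

open MismatchState

variable (k : ℕ) (h : Bool → ℕ → List ℕ) (p : List ℕ)

/-- The transitions of the machine, for words `w` in `emit i w` that are not restricted. -/
inductive MismatchTransition :
    MismatchState → ℕ → Bool → MismatchState → Bool → ℤ → Prop
  | start {c : ℕ} (i pos : Bool) (hc : c < k) :
      MismatchTransition start c pos (emit i (bif i then p else [])) false 0
  | count {c : ℕ} (i pos : Bool) (b : ℕ) (w : List ℕ) (hc : c < k) :
      MismatchTransition (emit i (b :: w)) c pos (emit i w) false 1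
  | choose {c : ℕ} (i pos : Bool) (b : ℕ) (w : List ℕ) (hc : c < k) :
      MismatchTransition (emit i (b :: w)) c pos (chosen b) false 0
  | read {c : ℕ} (i pos : Bool) (hc : c < k) (h0 : c ≠ 0) :
      MismatchTransition (emit i []) c pos (emit i (h i c)) true 0
  | last {c : ℕ} (i pos : Bool) (hc : c < k) (h0 : c = 0) :
      MismatchTransition (emit i []) c pos (chosen 0) false 0
  | skip {c : ℕ} (pos : Bool) (b : ℕ) (hc : c < k) (h0 : c ≠ 0) :
      MismatchTransition (chosen b) c pos (chosen b) true 0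
  | sep {c : ℕ} (pos : Bool) (b : ℕ) (hc : c < k) (h0 : c = 0) :
      MismatchTransition (chosen b) c pos (seek b) true 0
  | down {c : ℕ} (b : ℕ) (hc : c < k) :
      MismatchTransition (seek b) c true (seek b) true (-1)
  | found {c : ℕ} (b : ℕ) (hc : c < k) (hb : c ≠ b) :
      MismatchTransition (seek b) c false accept true 0
  | loop {c : ℕ} (pos : Bool) (hc : c < k) :
      MismatchTransition accept c pos accept true 0

/-- The states that the machine really has. -/
def MismatchState.Live : MismatchState → Prop
  | emit i w => (i = true ∧ w <:+ p) ∨ ∃ a < k, w <:+ h i a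
  | chosen b => b < k
  | seek b => b < k
  | _ => True

/-- A transition in the format of the machine descriptions. -/
def counterTransition (s : MismatchState) (c : ℕ) (pos : Bool) (s' : MismatchState) (mv : Bool)
    (d : ℤ) : CounterTransition :=
  ⟨s.code, some c, pos, s'.code, mv, d⟩

/-- All pairs of a test of the counter and an input letter. -/
def readings : List (Bool × ℕ) :=
  [false, true].flatMap fun pos => (List.range k).map fun c => (pos, c)

theorem mem_readings {x : Bool × ℕ} : x ∈ readings k ↔ x.2 < k := by
  obtain ⟨pos, c⟩ := x
  cases pos <;> simp [readings]

/-- The transitions that count letters of the word `w`. -/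
def countTransitions (i : Bool) : List ℕ → List CounterTransition
  | [] => []
  | b :: w => ((readings k).flatMap fun x =>
      [counterTransition (emit i (b :: w)) x.2 x.1 (emit i w) false 1,
        counterTransition (emit i (b :: w)) x.2 x.1 (chosen b) false 0]) ++ countTransitions i w

/-- The transitions in the state `start`. -/
def startTransitions : List CounterTransition :=
  (readings k).flatMap fun x =>
    [counterTransition start x.2 x.1 (emit false []) false 0,
      counterTransition start x.2 x.1 (emit true p) false 0]

/-- The transitions that do not depend on the word `p`. -/
def fixedTransitions : List CounterTransition :=
  ([false, true].flatMap fun i => (List.range k).flatMap fun a => countTransitions k i (h i a)) ++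
  (readings k).flatMap fun x =>
    counterTransition accept x.2 x.1 accept true 0 ::
    (([false, true].map fun i =>
        if x.2 = 0 then counterTransition (emit i []) x.2 x.1 (chosen 0) false 0
        else counterTransition (emit i []) x.2 x.1 (emit i (h i x.2)) true 0) ++
      (List.range k).flatMap fun b =>
        (if x.2 = 0 then counterTransition (chosen b) x.2 x.1 (seek b) true 0
        else counterTransition (chosen b) x.2 x.1 (chosen b) true 0) ::
        if x.1 then [counterTransition (seek b) x.2 x.1 (seek b) true (-1)]
        else if x.2 = b then []
        else [counterTransition (seek b) x.2 x.1 accept true 0])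

/-- All transitions of the machine. -/
def mismatchTransitions : List CounterTransition :=
  (startTransitions k p ++ countTransitions k true p) ++ fixedTransitions k h

/-- The machine that looks for a mismatch. -/
def mismatchMachine : CounterMachine where
  numStates := (mismatchTransitions k h p).foldr (fun t n => max (max t.src t.tgt) n) accept.code + 1
  alphabetSize := k
  transitions := mismatchTransitions k h p
  start := start.code
  finals := [accept.code]

variable {k h p}

/-! ### The transition list against the transition relation -/

theorem mem_countTransitions {i : Bool} {W : List ℕ} {t : CounterTransition} :
    t ∈ countTransitions k i W ↔ ∃ b w, (b :: w) <:+ W ∧ ∃ c < k, ∃ pos,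
      t = counterTransition (emit i (b :: w)) c pos (emit i w) false 1 ∨
      t = counterTransition (emit i (b :: w)) c pos (chosen b) false 0 := by
  induction W with
  | nil => simp [countTransitions]
  | cons a W ih =>
    simp only [countTransitions, List.mem_append, ih, List.mem_flatMap, mem_readings,
      List.suffix_cons_iff, List.mem_cons, List.not_mem_nil, or_false]
    constructor
    · rintro (⟨⟨pos, c⟩, hc, ht⟩ | ⟨b, w, hw, h⟩)
      · exact ⟨a, W, .inl rfl, c, hc, pos, ht⟩
      · exact ⟨b, w, .inr hw, h⟩
    · rintro ⟨b, w, hw | hw, c, hc, pos, ht⟩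
      · obtain ⟨rfl, rfl⟩ := List.cons.inj hw
        exact .inl ⟨(pos, c), hc, ht⟩
      · exact .inr ⟨b, w, hw, c, hc, pos, ht⟩

theorem exists_mismatchTransition {t : CounterTransition} (ht : t ∈ mismatchTransitions k h p) :
    ∃ s c pos s' mv d, MismatchTransition k h p s c pos s' mv d ∧
      t = counterTransition s c pos s' mv d := by
  have hcount : ∀ i W, t ∈ countTransitions k i W →
      ∃ s c pos s' mv d, MismatchTransition k h p s c pos s' mv d ∧
        t = counterTransition s c pos s' mv d := by
    intro i W ht
    obtain ⟨b, w, -, c, hc, pos, rfl | rfl⟩ := mem_countTransitions.1 ht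
    · exact ⟨_, _, _, _, _, _, .count i pos b w hc, rfl⟩
    · exact ⟨_, _, _, _, _, _, .choose i pos b w hc, rfl⟩
  simp only [mismatchTransitions, fixedTransitions, List.mem_append, List.mem_flatMap] at ht
  rcases ht with (ht | ht) | ⟨i, -, a, -, ht⟩ | ⟨⟨pos, c⟩, hx, ht⟩
  · simp only [startTransitions, List.mem_flatMap, mem_readings] at ht
    obtain ⟨⟨pos, c⟩, hc, ht⟩ := ht
    simp only [List.mem_cons, List.not_mem_nil, or_false] at ht
    rcases ht with rfl | rfl
    · exact ⟨_, _, _, _, _, _, .start false pos hc, rfl⟩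
    · exact ⟨_, _, _, _, _, _, .start true pos hc, rfl⟩
  · exact hcount _ _ ht
  · exact hcount _ _ ht
  · have hc : c < k := (mem_readings k).1 hx
    rw [List.mem_cons, List.mem_append, List.mem_map, List.mem_flatMap] at ht
    rcases ht with rfl | ⟨i, -, rfl⟩ | ⟨b, -, ht⟩
    · exact ⟨_, _, _, _, _, _, .loop pos hc, rfl⟩
    · by_cases h0 : c = 0
      · exact ⟨_, _, _, _, _, _, .last i pos hc h0, if_pos h0⟩
      · exact ⟨_, _, _, _, _, _, .read i pos hc h0, if_neg h0⟩
    · rcases List.mem_cons.1 ht with rfl | ht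
      · by_cases h0 : c = 0
        · exact ⟨_, _, _, _, _, _, .sep pos b hc h0, if_pos h0⟩
        · exact ⟨_, _, _, _, _, _, .skip pos b hc h0, if_neg h0⟩
      · cases pos with
        | true =>
          simp only [if_true, List.mem_singleton] at ht
          exact ⟨_, _, _, _, _, _, .down b hc, ht⟩
        | false =>
          by_cases hb : c = b
          · simp [hb] at ht
          · simp only [Bool.false_eq_true, if_false, if_neg hb, List.mem_singleton] at ht
            exact ⟨_, _, _, _, _, _, .found b hc hb, ht⟩

/-- The relation has infinitely many states, the list only finitely many transitions; liveness of
the source state is what puts a transition in the list. -/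
theorem mem_mismatchTransitions {s s' : MismatchState} {c : ℕ} {pos mv : Bool} {d : ℤ}
    (ht : MismatchTransition k h p s c pos s' mv d) (hs : s.Live k h p) :
    counterTransition s c pos s' mv d ∈ mismatchTransitions k h p := by
  have hcount : ∀ {i b w t}, (emit i (b :: w)).Live k h p →
      (∀ W, (b :: w) <:+ W → t ∈ countTransitions k i W) → t ∈ mismatchTransitions k h p := by
    rintro i b w t (⟨rfl, hw⟩ | ⟨a, ha, hw⟩) ht
    · simp [mismatchTransitions, ht _ hw]
    · simp only [mismatchTransitions, fixedTransitions, List.mem_append, List.mem_flatMap,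
        List.mem_range]
      exact .inr (.inl ⟨i, by simp, a, ha, ht _ hw⟩)
  have hread : ∀ {t}, c < k → t ∈ (counterTransition accept c pos accept true 0 ::
      (([false, true].map fun i =>
          if c = 0 then counterTransition (emit i []) c pos (chosen 0) false 0
          else counterTransition (emit i []) c pos (emit i (h i c)) true 0) ++
        (List.range k).flatMap fun b =>
          (if c = 0 then counterTransition (chosen b) c pos (seek b) true 0
          else counterTransition (chosen b) c pos (chosen b) true 0) ::
          if pos then [counterTransition (seek b) c pos (seek b) true (-1)]
          else if c = b then []
          else [counterTransition (seek b) c pos accept true 0])) →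
      t ∈ mismatchTransitions k h p := by
    intro t hc ht
    exact List.mem_append_right _ (List.mem_append_right _
      (List.mem_flatMap.2 ⟨(pos, c), (mem_readings k).2 hc, ht⟩))
  cases ht with
  | start i _ hc =>
    refine List.mem_append_left _ (List.mem_append_left _ (List.mem_flatMap.2
      ⟨(pos, c), (mem_readings k).2 hc, ?_⟩))
    cases i <;> simp
  | count i _ b w hc =>
    exact hcount hs fun W hW => mem_countTransitions.2 ⟨b, w, hW, c, hc, pos, .inl rfl⟩
  | choose i _ b w hc =>
    exact hcount hs fun W hW => mem_countTransitions.2 ⟨b, w, hW, c, hc, pos, .inr rfl⟩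
  | read i _ hc h0 => exact hread hc (by cases i <;> simp [h0])
  | last i _ hc h0 => exact hread hc (by cases i <;> simp [h0])
  | skip _ b hc h0 =>
    have hb : b < k := hs
    refine hread hc (List.mem_cons_of_mem _ (List.mem_append_right _
      (List.mem_flatMap.2 ⟨b, by simpa using hb, by simp [h0]⟩)))
  | sep _ b hc h0 =>
    have hb : b < k := hs
    refine hread hc (List.mem_cons_of_mem _ (List.mem_append_right _
      (List.mem_flatMap.2 ⟨b, by simpa using hb, by simp [h0]⟩)))
  | down b hc =>
    have hb : b < k := hs
    refine hread hc (List.mem_cons_of_mem _ (List.mem_append_right _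
      (List.mem_flatMap.2 ⟨b, by simpa using hb, by simp⟩)))
  | found b hc hcb =>
    have hb : b < k := hs
    refine hread hc (List.mem_cons_of_mem _ (List.mem_append_right _
      (List.mem_flatMap.2 ⟨b, by simpa using hb, by simp [hcb]⟩)))
  | loop _ hc => exact hread hc (by simp)

theorem le_foldr_max (l : List CounterTransition) (n : ℕ) :
    n ≤ l.foldr (fun t n => max (max t.src t.tgt) n) n ∧
      ∀ t ∈ l, max t.src t.tgt ≤ l.foldr (fun t n => max (max t.src t.tgt) n) n := by
  induction l with
  | nil => simp
  | cons a l ih =>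
    simp only [List.foldr_cons, List.mem_cons, forall_eq_or_imp]
    exact ⟨ih.1.trans (le_max_right _ _), le_max_left _ _,
      fun t ht => (ih.2 t ht).trans (le_max_right _ _)⟩

theorem mismatchMachine_wellFormed : (mismatchMachine k h p).WellFormed := by
  have hle := le_foldr_max (mismatchTransitions k h p) accept.code
  refine ⟨?_, ?_, fun t ht => ⟨?_, ?_, ?_⟩⟩
  · exact Nat.lt_succ_of_le (Nat.zero_le _)
  · intro q hq
    rw [List.mem_singleton.1 hq]
    exact Nat.lt_succ_of_le hle.1
  · exact Nat.lt_succ_of_le ((le_max_left _ _).trans (hle.2 t ht))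
  · exact Nat.lt_succ_of_le ((le_max_right _ _).trans (hle.2 t ht))
  · obtain ⟨s, c, pos, s', mv, d, hT, rfl⟩ := exists_mismatchTransition ht
    cases hT <;> simpa [counterTransition, mismatchMachine]

theorem exists_of_step {C C' : CounterConfig} {d : ℤ} (hstep : (mismatchMachine k h p).Step C d C') :
    ∃ s c pos s' mv w, MismatchTransition k h p s c pos s' mv d ∧ C.state = s.code ∧
      C.input = some c :: w ∧ (pos = true ↔ C.counter ≠ 0) ∧ C'.state = s'.code ∧
      C'.input = (if mv then w else some c :: w) ∧ (C'.counter : ℤ) = C.counter + d := by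
  obtain ⟨t, ht, w, h1, h2, h3, h4, h5, h6, rfl⟩ := hstep
  obtain ⟨s, c, pos, s', mv, d, hT, rfl⟩ := exists_mismatchTransition ht
  exact ⟨s, c, pos, s', mv, w, hT, h1, h2, h3, h4, h5, h6⟩

/-! #### Reversals -/

theorem destutter'_of_forall_eq {a : ℤ} {l : List ℤ} (hl : ∀ x ∈ l, x = a) :
    l.destutter' (fun x y => x ≠ y) a = [a] := by
  induction l with
  | nil => simp
  | cons b l ih =>
    obtain rfl := hl b (by simp)
    rw [List.destutter'_cons_neg _ (by simp)]
    exact ih fun x hx => hl x (by simp [hx])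

theorem length_destutter'_le_two {a b : ℤ} {A B : List ℤ} (hA : ∀ x ∈ A, x = a)
    (hB : ∀ x ∈ B, x = b) : ((A ++ B).destutter' (fun x y => x ≠ y) a).length ≤ 2 := by
  induction A with
  | nil =>
    cases B with
    | nil => simp
    | cons c B =>
      obtain rfl := hB c (by simp)
      have hB' := destutter'_of_forall_eq (a := c) (l := B) fun x hx => hB x (by simp [hx])
      by_cases hac : a = c
      · subst hac
        simp [hB']
      · rw [List.nil_append, List.destutter'_cons_pos _ hac, hB']
        simp
  | cons c A ih =>
    obtain rfl := hA c (by simp)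
    rw [List.cons_append, List.destutter'_cons_neg _ (by simp)]
    exact ih fun x hx => hA x (by simp [hx])

theorem reversals_le_one {A B : List ℤ} (hA : ∀ d ∈ A, d = 0 ∨ d = 1)
    (hB : ∀ d ∈ B, d = 0 ∨ d = -1) : CounterMachine.reversals (A ++ B) ≤ 1 := by
  rw [CounterMachine.reversals, List.filter_append]
  have hA' : ∀ d ∈ A.filter (fun d => d ≠ 0), d = 1 := by
    intro d hd
    simp only [List.mem_filter, decide_eq_true_eq] at hd
    exact (hA d hd.1).resolve_left hd.2
  have hB' : ∀ d ∈ B.filter (fun d => d ≠ 0), d = -1 := by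
    intro d hd
    simp only [List.mem_filter, decide_eq_true_eq] at hd
    exact (hB d hd.1).resolve_left hd.2
  generalize A.filter (fun d => d ≠ 0) = A at hA'
  generalize B.filter (fun d => d ≠ 0) = B at hB'
  refine Nat.sub_le_of_le_add ?_
  cases A with
  | nil =>
    cases B with
    | nil => simp
    | cons b B =>
      obtain rfl := hB' b (by simp)
      exact length_destutter'_le_two (A := []) (by simp) fun x hx => hB' x (by simp [hx])
  | cons a A =>
    obtain rfl := hA' a (by simp)
    exact length_destutter'_le_two (fun x hx => hA' x (by simp [hx])) hB'

/-- Late states are never left, and the counter never goes up from them nor down from the others. So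
every run, accepting or not, splits at its entry into the late states. -/
theorem run_changes {C C' : CounterConfig} {ds : List ℤ} (hrun : (mismatchMachine k h p).Run C ds C')
    (s : MismatchState) (hs : C.state = s.code) :
    (s.Late → ∀ d ∈ ds, d = 0 ∨ d = -1) ∧ ∃ A B, ds = A ++ B ∧
      (∀ d ∈ A, d = 0 ∨ d = 1) ∧ ∀ d ∈ B, d = 0 ∨ d = -1 := by
  induction hrun generalizing s with
  | refl => exact ⟨by simp, [], [], by simp⟩
  | @head C C' C'' d ds hstep _ ih =>
    obtain ⟨s₁, c, pos, s', mv, w, hT, h1, -, -, h4, -, -⟩ := exists_of_step hstep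
    obtain rfl := code_injective (hs.symm.trans h1)
    obtain ⟨hlate, A, B, rfl, hA, hB⟩ := ih s' h4
    have hdown : s.Late → s'.Late ∧ (d = 0 ∨ d = -1) := by
      cases hT <;> simp [Late]
    have hup : ¬ s.Late → d = 0 ∨ d = 1 := by
      cases hT <;> simp [Late]
    have hall : s.Late → ∀ e ∈ d :: (A ++ B), e = 0 ∨ e = -1 := by
      intro hs e he
      rcases List.mem_cons.1 he with rfl | he
      · exact (hdown hs).2
      · exact hlate (hdown hs).1 e he
    refine ⟨hall, ?_⟩
    by_cases hs : s.Late
    · exact ⟨[], _, rfl, by simp, hall hs⟩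
    · refine ⟨d :: A, B, rfl, ?_, hB⟩
      intro e he
      rcases List.mem_cons.1 he with rfl | he
      · exact hup hs
      · exact hA e he

theorem mismatchMachine_isNCMOne : (mismatchMachine k h p).IsNCMOne 1 := by
  refine ⟨mismatchMachine_wellFormed, ?_⟩
  rintro w ds ⟨q, -, c, hrun⟩
  obtain ⟨-, A, B, rfl, hA, hB⟩ := run_changes hrun start rfl
  exact reversals_le_one hA hB

/-! #### Accepted words -/

variable (h p) in
/-- What acceptance from the state `s`, with the remaining tape `T` and the counter `n`, tells. -/
def MismatchState.Promise : MismatchState → List (Option ℕ) → ℕ → Prop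
  | start, T, n => ∃ i, ∃ (α : List ℕ) (z : List (Option ℕ)), T = α.map some ++ some 0 :: z ∧ 0 ∉ α ∧ ∃ (j b x : ℕ),
      (dominoRow h p i α)[j]? = some b ∧ z[n + j]? = some (some x) ∧ x ≠ b
  | emit i u, T, n => ∃ (α : List ℕ) (z : List (Option ℕ)), T = α.map some ++ some 0 :: z ∧ 0 ∉ α ∧ ∃ (j b x : ℕ),
      (u ++ α.flatMap (h i) ++ [0])[j]? = some b ∧ z[n + j]? = some (some x) ∧ x ≠ b
  | chosen b, T, n => ∃ (α : List ℕ) (z : List (Option ℕ)), T = α.map some ++ some 0 :: z ∧ 0 ∉ α ∧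
      ∃ x : ℕ, z[n]? = some (some x) ∧ x ≠ b
  | seek b, T, n => ∃ x : ℕ, T[n]? = some (some x) ∧ x ≠ b
  | accept, _, _ => True

theorem eq_nil_of_cons_zero_eq {α : List ℕ} {T z : List (Option ℕ)} (hα : 0 ∉ α)
    (h : some 0 :: T = α.map some ++ some 0 :: z) : α = [] ∧ T = z := by
  cases α <;> simp_all

/-- The promise is carried backwards. While a row is emitted, `n + j` is constant: it is the guessed
position, of which `n` letters are counted and `j` are still to come. -/
theorem promise_of_transition {s s' : MismatchState} {c : ℕ} {pos mv : Bool} {d : ℤ}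
    {w : List (Option ℕ)} {n n' : ℕ} (hT : MismatchTransition k h p s c pos s' mv d)
    (hpos : pos = true ↔ n ≠ 0) (hn : (n' : ℤ) = n + d)
    (hp : s'.Promise h p (if mv then w else some c :: w) n') :
    s.Promise h p (some c :: w) n := by
  cases hT with
  | start i => exact ⟨i, by simpa [Promise, dominoRow, show n' = n by omega] using hp⟩
  | count i _ b u =>
    obtain ⟨α, z, hT, hα, j, b', x, h1, h2, h3⟩ := hp
    refine ⟨α, z, hT, hα, j + 1, b', x, by simpa using h1, ?_, h3⟩
    rw [← h2]
    congr 1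
    omega
  | choose i _ b u =>
    obtain ⟨α, z, hT, hα, x, h1, h2⟩ := hp
    exact ⟨α, z, hT, hα, 0, b, x, by simp, by rwa [show n + 0 = n' by omega], h2⟩
  | read i _ hc h0 =>
    obtain ⟨α, z, hT, hα, j, b, x, h1, h2, h3⟩ := hp
    refine ⟨c :: α, z, by simpa using hT, by simpa [hα] using h0.symm, j, b, x,
      by simpa using h1, by rwa [show n = n' by omega], h3⟩
  | last i _ hc h0 =>
    obtain ⟨α, z, hT, hα, x, h1, h2⟩ := hp
    subst h0
    obtain ⟨rfl, rfl⟩ := eq_nil_of_cons_zero_eq hα hT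
    exact ⟨[], _, rfl, hα, 0, 0, x, by simp, by rwa [show n + 0 = n' by omega], h2⟩
  | skip _ b hc h0 =>
    obtain ⟨α, z, hT, hα, x, h1, h2⟩ := hp
    exact ⟨c :: α, z, by simpa using hT, by simpa [hα] using h0.symm, x,
      by rwa [show n = n' by omega], h2⟩
  | sep _ b hc h0 =>
    obtain ⟨x, h1, h2⟩ := hp
    subst h0
    exact ⟨[], w, rfl, by simp, x, by rw [show n = n' by omega]; exact h1, h2⟩
  | down b hc =>
    obtain ⟨x, h1, h2⟩ := hp
    refine ⟨x, ?_, h2⟩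
    rw [show n = n' + 1 by omega]
    simpa using h1
  -- The zero test certifies that the scanned letter is the one at the guessed position.
  | found b hc hb =>
    have hn0 : n = 0 := by simpa using hpos
    exact ⟨c, by simp [hn0], hb⟩
  | loop => trivial

theorem promise_of_run {C C' : CounterConfig} {ds : List ℤ}
    (hrun : (mismatchMachine k h p).Run C ds C') (hC' : C'.state = accept.code)
    (s : MismatchState) (hs : C.state = s.code) : s.Promise h p C.input C.counter := by
  induction hrun generalizing s with
  | refl =>
    obtain rfl := code_injective (hs.symm.trans hC')
    trivial
  | head hstep _ ih =>
    obtain ⟨s₁, c, pos, s', mv, w, hT, h1, h2, h3, h4, h5, h6⟩ := exists_of_step hstep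
    obtain rfl := code_injective (hs.symm.trans h1)
    have := ih hC' s' h4
    rw [h5] at this
    rw [h2]
    exact promise_of_transition hT h3 h6 this

/-! ### Accepting computations for words with a mismatch -/

variable (k h p) in
/-- Some computation from the given configuration accepts. -/
def Accepts (s : MismatchState) (w : List ℕ) (n : ℕ) : Prop :=
  ∃ ds c, (mismatchMachine k h p).Run ⟨s.code, w.map some ++ [none], n⟩ ds ⟨accept.code, [none], c⟩

theorem Accepts.of_transition {s s' : MismatchState} {c : ℕ} {pos mv : Bool} {d : ℤ}
    {w : List ℕ} {n n' : ℕ} (hT : MismatchTransition k h p s c pos s' mv d) (hs : s.Live k h p)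
    (hpos : pos = true ↔ n ≠ 0) (hn : (n' : ℤ) = n + d)
    (ha : Accepts k h p s' (if mv then w else c :: w) n') :
    Accepts k h p s (c :: w) n := by
  obtain ⟨ds, e, hrun⟩ := ha
  refine ⟨d :: ds, e, .head ⟨_, mem_mismatchTransitions hT hs, w.map some ++ [none], rfl, rfl, hpos,
    rfl, ?_, hn, rfl⟩ hrun⟩
  cases mv <;> rfl

theorem decide_iff_ne_zero (n : ℕ) : decide (n ≠ 0) = true ↔ n ≠ 0 := decide_eq_true_iff

theorem accepts_accept (w : List ℕ) (hw : ∀ x ∈ w, x < k) (n : ℕ) :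
    Accepts k h p accept w n := by
  induction w with
  | nil => exact ⟨[], n, .refl _⟩
  | cons c w ih =>
    exact .of_transition (.loop _ (hw c (by simp))) trivial (decide_iff_ne_zero n) (by simp)
      (ih fun x hx => hw x (by simp [hx]))

theorem accepts_seek {b : ℕ} (hb : b < k) (w : List ℕ) (hw : ∀ x ∈ w, x < k) (n x : ℕ)
    (hx : w[n]? = some x) (hxb : x ≠ b) : Accepts k h p (seek b) w n := by
  induction w generalizing n with
  | nil => simp at hx
  | cons c w ih =>
    have hw' : ∀ x ∈ w, x < k := fun x hx => hw x (by simp [hx])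
    cases n with
    | zero =>
      obtain rfl : c = x := by simpa using hx
      exact .of_transition (.found b (hw c (by simp)) hxb) hb (by simp) (by simp)
        (accepts_accept w hw' 0)
    | succ n =>
      exact .of_transition (.down b (hw c (by simp))) hb (by simp) (by simp)
        (ih hw' n (by simpa using hx))

theorem accepts_chosen {b : ℕ} (hb : b < k) (α z : List ℕ) (hα : ∀ x ∈ α, x < k) (hα0 : 0 ∉ α)
    (hz : ∀ x ∈ z, x < k) (n x : ℕ) (hx : z[n]? = some x) (hxb : x ≠ b) :
    Accepts k h p (chosen b) (α ++ 0 :: z) n := by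
  induction α with
  | nil =>
    exact .of_transition (.sep _ b (by omega) rfl) hb (decide_iff_ne_zero n) (by simp)
      (accepts_seek hb z hz n x hx hxb)
  | cons c α ih =>
    simp only [List.mem_cons, not_or] at hα0
    exact .of_transition (.skip _ b (hα c (by simp)) (Ne.symm hα0.1)) hb (decide_iff_ne_zero n)
      (by simp) (ih (fun x hx => hα x (by simp [hx])) hα0.2)

variable (k h p) in
/-- The letters of the dominoes and of the word `p` are nonzero letters of the alphabet. -/
def DominoLetters : Prop :=
  0 < k ∧ (∀ i a, ∀ x ∈ h i a, 0 < x ∧ x < k) ∧ ∀ x ∈ p, 0 < x ∧ x < k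

theorem lt_of_live_emit (hl : DominoLetters k h p) {i : Bool} {u : List ℕ}
    (hu : (emit i u).Live k h p) : ∀ x ∈ u, x < k := by
  intro x hx
  rcases hu with ⟨-, hu⟩ | ⟨a, -, hu⟩
  · exact (hl.2.2 x (hu.subset hx)).2
  · exact (hl.2.1 i a x (hu.subset hx)).2

theorem MismatchState.Live.tail {i : Bool} {b : ℕ} {u : List ℕ}
    (hu : (emit i (b :: u)).Live k h p) : (emit i u).Live k h p := by
  rcases hu with ⟨hi, hu⟩ | ⟨a, ha, hu⟩
  · exact .inl ⟨hi, (List.suffix_cons b u).trans hu⟩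
  · exact .inr ⟨a, ha, (List.suffix_cons b u).trans hu⟩

/-- The machine counts a letter of `u` while `j > 0` and chooses it when `j = 0`; with `u` empty it
reads the next domino. If `α` is exhausted too, only the closing `0` can be chosen. -/
theorem accepts_emit (hl : DominoLetters k h p) {i : Bool} (α z : List ℕ) (hα : ∀ x ∈ α, x < k)
    (hα0 : 0 ∉ α) (hz : ∀ x ∈ z, x < k) (u : List ℕ) (hu : (emit i u).Live k h p) (n j b x : ℕ)
    (hb : (u ++ α.flatMap (h i) ++ [0])[j]? = some b) (hx : z[n + j]? = some x) (hxb : x ≠ b) :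
    Accepts k h p (emit i u) (α ++ 0 :: z) n := by
  induction α generalizing u n j with
  | nil =>
    induction u generalizing n j with
    | nil =>
      cases j with
      | zero =>
        obtain rfl : 0 = b := by simpa using hb
        exact .of_transition (.last i _ hl.1 rfl) hu (decide_iff_ne_zero n) (by simp)
          (accepts_chosen hl.1 [] z (by simp) (by simp) hz n x (by simpa using hx) hxb)
      | succ j => simp at hb
    | cons a u ih =>
      cases j with
      | zero =>
        obtain rfl : a = b := by simpa using hb
        exact .of_transition (.choose i _ a u hl.1) hu (decide_iff_ne_zero n) (by simp)
          (accepts_chosen (lt_of_live_emit hl hu a (by simp)) [] z (by simp) (by simp) hz n x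
            (by simpa using hx) hxb)
      | succ j =>
        exact .of_transition (.count i _ a u hl.1) hu (decide_iff_ne_zero n) (by simp)
          (ih hu.tail (n + 1) j (by simpa using hb) (by rwa [add_assoc, add_comm 1 j]))
  | cons c α ihα =>
    have hα' : ∀ x ∈ α, x < k := fun x hx => hα x (by simp [hx])
    have hc : c < k := hα c (by simp)
    have hα0' := hα0
    simp only [List.mem_cons, not_or] at hα0'
    induction u generalizing n j with
    | nil =>
      refine .of_transition (.read i _ hc (Ne.symm hα0'.1)) hu (decide_iff_ne_zero n) (by simp)
        (ihα hα' hα0'.2 (h i c) (.inr ⟨c, hc, List.suffix_rfl⟩) n j (by simpa using hb) hx)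
    | cons a u ih =>
      cases j with
      | zero =>
        obtain rfl : a = b := by simpa using hb
        exact .of_transition (.choose i _ a u hc) hu (decide_iff_ne_zero n) (by simp)
          (accepts_chosen (lt_of_live_emit hl hu a (by simp)) (c :: α) z hα hα0 hz n x
            (by simpa using hx) hxb)
      | succ j =>
        exact .of_transition (.count i _ a u hc) hu (decide_iff_ne_zero n) (by simp)
          (ih hu.tail (n + 1) j (by simpa using hb) (by rwa [add_assoc, add_comm 1 j]))

theorem tape_eq (w : List (Fin k)) :
    CounterMachine.tape w = (w.map Fin.val).map some ++ [none] := by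
  induction w with
  | nil => rfl
  | cons a w ih =>
    rw [List.map_cons, List.map_cons, List.cons_append, ← ih]
    rfl

theorem mem_mismatchMachine_language (hl : DominoLetters k h p) (w : List (Fin k)) :
    w ∈ (mismatchMachine k h p).language ↔ ∃ α z : List ℕ, w.map Fin.val = α ++ 0 :: z ∧ 0 ∉ α ∧
      ∃ (i : Bool) (j b x : ℕ), (dominoRow h p i α)[j]? = some b ∧ z[j]? = some x ∧ x ≠ b := by
  have htape := tape_eq w
  constructor
  · rintro ⟨ds, q, hq, c, hrun⟩
    obtain rfl := List.mem_singleton.1 hq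
    obtain ⟨i, α, z', hT, hα, j, b, x, h1, h2, h3⟩ := promise_of_run hrun rfl start rfl
    change CounterMachine.tape w = _ at hT
    rw [htape] at hT
    -- `z'` still ends with the end-marker, which is split off; the mismatching entry is a letter
    -- and hence lies before it.
    rcases List.eq_nil_or_concat z' with rfl | ⟨z', y, rfl⟩
    · simp at h2
    · rw [List.concat_eq_append, ← List.cons_append, ← List.append_assoc] at hT
      obtain ⟨hT', hy⟩ := List.append_inj' hT rfl
      obtain rfl : none = y := by simpa using hy
      obtain ⟨α', z, hw, hα', hz⟩ := List.map_eq_append_iff.1 hT'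
      obtain rfl : α' = α := List.map_injective_iff.2 (Option.some_injective _) hα'
      obtain ⟨x0, z, rfl, hx0, rfl⟩ := List.map_eq_cons_iff.1 hz
      obtain rfl : x0 = 0 := by simpa using hx0
      refine ⟨α', z, hw, hα, i, j, b, x, h1, ?_, h3⟩
      simp only [zero_add, List.concat_eq_append] at h2
      rw [List.getElem?_append] at h2
      split at h2
      · simpa using h2
      · rw [List.getElem?_singleton] at h2
        split at h2 <;> simp at h2
  · rintro ⟨α, z, hw, hα0, i, j, b, x, h1, h2, h3⟩
    have hlt : ∀ x ∈ α ++ 0 :: z, x < k := by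
      rw [← hw]
      intro x hx
      obtain ⟨y, -, rfl⟩ := List.mem_map.1 hx
      exact y.2
    have hemit : Accepts k h p (emit i (bif i then p else [])) (α ++ 0 :: z) 0 := by
      refine accepts_emit hl α z (fun x hx => hlt x (by simp [hx])) hα0
        (fun x hx => hlt x (by simp [hx])) _ ?_ 0 j b x h1 (by simpa using h2) h3
      cases i
      · exact .inr ⟨0, hl.1, List.nil_suffix⟩
      · exact .inl ⟨rfl, List.suffix_rfl⟩
    have hstart : Accepts k h p start (α ++ 0 :: z) 0 := by
      obtain ⟨c, v, hcv⟩ : ∃ c v, α ++ 0 :: z = c :: v := by cases α <;> simp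
      rw [hcv] at hemit hlt ⊢
      exact .of_transition (.start i false (hlt c (by simp))) trivial (by simp) (by simp) hemit
    obtain ⟨ds, c, hrun⟩ := hstart
    refine ⟨ds, accept.code, List.mem_singleton.2 rfl, c, ?_⟩
    rw [← hw, ← htape] at hrun
    exact hrun

/-! #### Prefix density -/

/-- The closing `0` yields a mismatch even when one word is a proper prefix of the other. -/
theorem exists_getElem?_ne {X Y : List ℕ} (hX : 0 ∉ X) (hY : 0 ∉ Y) (hXY : X ≠ Y) :
    ∃ j a b : ℕ, (X ++ [0])[j]? = some a ∧ (Y ++ [0])[j]? = some b ∧ a ≠ b := by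
  induction X generalizing Y with
  | nil =>
    cases Y with
    | nil => exact absurd rfl hXY
    | cons b Y => exact ⟨0, 0, b, by simp, by simp, fun hb => hY (by simp [hb])⟩
  | cons a X ih =>
    cases Y with
    | nil => exact ⟨0, a, 0, by simp, by simp, fun ha => hX (by simp [ha])⟩
    | cons b Y =>
      by_cases hab : a = b
      · obtain ⟨j, a', b', h1, h2, h3⟩ := ih (Y := Y) (fun hx => hX (by simp [hx]))
          (fun hx => hY (by simp [hx])) fun hXY' => hXY (by rw [hab, hXY'])
        exact ⟨j + 1, a', b', by simpa using h1, by simpa using h2, h3⟩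
      · exact ⟨0, a, b, by simp, by simp, hab⟩

theorem exists_fin_map {l : List ℕ} (hl : ∀ x ∈ l, x < k) :
    ∃ w : List (Fin k), w.map Fin.val = l := by
  induction l with
  | nil => exact ⟨[], rfl⟩
  | cons a l ih =>
    obtain ⟨w, rfl⟩ := ih fun x hx => hl x (by simp [hx])
    exact ⟨⟨a, hl a (by simp)⟩ :: w, rfl⟩

theorem exists_eq_append_zero {l : List ℕ} (hl : 0 ∈ l) : ∃ α z, l = α ++ 0 :: z ∧ 0 ∉ α := by
  induction l with
  | nil => simp at hl
  | cons a l ih =>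
    by_cases ha : a = 0
    · exact ⟨[], l, by simp [ha], by simp⟩
    · obtain ⟨α, z, rfl, hα⟩ := ih ((List.mem_cons.1 hl).resolve_left (Ne.symm ha))
      exact ⟨a :: α, z, rfl, by simp [hα, Ne.symm ha]⟩

theorem append_zero_inj {α β y z : List ℕ} (hα : 0 ∉ α) (hβ : 0 ∉ β)
    (h : α ++ 0 :: y = β ++ 0 :: z) : α = β ∧ y = z := by
  induction α generalizing β with
  | nil =>
    cases β with
    | nil => exact ⟨rfl, (List.cons.inj h).2⟩
    | cons b β =>
      obtain ⟨rfl, -⟩ := List.cons.inj h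
      simp at hβ
  | cons a α ih =>
    cases β with
    | nil =>
      obtain ⟨rfl, -⟩ := List.cons.inj h
      simp at hα
    | cons b β =>
      obtain ⟨rfl, h'⟩ := List.cons.inj h
      obtain ⟨rfl, rfl⟩ := ih (List.not_mem_of_not_mem_cons hα) (List.not_mem_of_not_mem_cons hβ) h'
      exact ⟨rfl, rfl⟩

theorem prefixDense_iff_exists_mismatch (hl : DominoLetters k h p) :
    PrefixDense (mismatchMachine k h p).language ↔ ∀ w : List (Fin k), ∃ v : List (Fin k),
      ∃ α z : List ℕ, w.map Fin.val ++ v.map Fin.val = α ++ 0 :: z ∧ 0 ∉ α ∧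
        ∃ (i : Bool) (j b x : ℕ), (dominoRow h p i α)[j]? = some b ∧ z[j]? = some x ∧ x ≠ b := by
  refine forall_congr' fun w => exists_congr fun v => ?_
  refine (mem_mismatchMachine_language hl _).trans (iff_of_eq ?_)
  exact congrArg (fun l : List ℕ => ∃ α z : List ℕ, l = α ++ 0 :: z ∧ 0 ∉ α ∧
    ∃ (i : Bool) (j b x : ℕ), (dominoRow h p i α)[j]? = some b ∧ z[j]? = some x ∧ x ≠ b)
    List.map_append

theorem zero_notMem_row (hl : DominoLetters k h p) (i : Bool) (α : List ℕ) :
    0 ∉ (bif i then p else []) ++ α.flatMap (h i) := by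
  intro h0
  rcases List.mem_append.1 h0 with h0 | h0
  · cases i
    · simp at h0
    · exact absurd (hl.2.2 0 h0).1 (by simp)
  · obtain ⟨a, -, h0⟩ := List.mem_flatMap.1 h0
    exact absurd (hl.2.1 i a 0 h0).1 (by simp)

/-- The language of the machine is prefix-dense if and only if the domino problem has no
solution. -/
theorem prefixDense_mismatchMachine_iff (hl : DominoLetters k h p) :
    PrefixDense (mismatchMachine k h p).language ↔ ¬ ∃ α : List ℕ, (∀ a ∈ α, 0 < a ∧ a < k) ∧
      α.flatMap (h false) = p ++ α.flatMap (h true) := by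
  rw [prefixDense_iff_exists_mismatch hl]
  constructor
  · rintro hd ⟨α, hα, heq⟩
    have hrow : ∀ i, dominoRow h p i α = α.flatMap (h false) ++ [0] := by
      intro i
      cases i <;> simp [dominoRow, heq]
    have hα0 : 0 ∉ α := fun h0 => absurd (hα 0 h0).1 (by simp)
    have hlt : ∀ x ∈ α ++ 0 :: (α.flatMap (h false) ++ [0]), x < k := by
      intro x hx
      simp only [List.mem_append, List.mem_cons, List.mem_flatMap, List.not_mem_nil, or_false] at hx
      rcases hx with hx | rfl | ⟨a, -, hx⟩ | rfl
      exacts [(hα x hx).2, hl.1, (hl.2.1 false a x hx).2, hl.1]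
    obtain ⟨w, hw⟩ := exists_fin_map hlt
    obtain ⟨v, α', z, hz, hα0', i, j, b, x, h1, h2, h3⟩ := hd w
    rw [hw, List.append_assoc, List.cons_append] at hz
    obtain ⟨rfl, rfl⟩ := append_zero_inj hα0 hα0' hz
    rw [← hrow i] at h2
    -- The position lies inside the closed row, out of reach of the extension `v`.
    rw [List.getElem?_append_left (List.getElem?_eq_some_iff.1 h1).1, h1] at h2
    exact h3 (Option.some.inj h2).symm
  · intro hno w
    obtain ⟨α, z, hw, hα0⟩ := exists_eq_append_zero
      (l := w.map Fin.val ++ [0]) (by simp)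
    have hα : ∀ a ∈ α, 0 < a ∧ a < k := by
      intro a ha
      have ha0 : a ≠ 0 := fun h0 => hα0 (h0 ▸ ha)
      have : a ∈ w.map Fin.val ++ [0] := by rw [hw]; simp [ha]
      rcases List.mem_append.1 this with h | h
      · obtain ⟨y, -, rfl⟩ := List.mem_map.1 h
        exact ⟨Nat.pos_of_ne_zero ha0, y.2⟩
      · exact absurd (List.mem_singleton.1 h) ha0
    obtain ⟨j, a, b, ha, hb, hab⟩ := exists_getElem?_ne (zero_notMem_row hl false α)
      (zero_notMem_row hl true α) fun heq => hno ⟨α, hα, by simpa using heq⟩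
    -- The extension consists of `j + 2` zeros: one guarantees a separator, and `j + 1` make `z`
    -- reach position `j`.
    have hj : j < (z ++ List.replicate (j + 1) 0).length := by simp; omega
    refine ⟨⟨0, hl.1⟩ :: List.replicate (j + 1) ⟨0, hl.1⟩, α, z ++ List.replicate (j + 1) 0, ?_,
      hα0, ?_⟩
    · rw [← List.cons_append, ← List.append_assoc, ← hw]
      simp
    -- A letter equal to `a` differs from `b`, so one of the rows is contradicted.
    · by_cases hx : (z ++ List.replicate (j + 1) 0)[j] = a
      · exact ⟨true, j, b, _, hb, List.getElem?_eq_getElem hj, fun h => hab (hx.symm.trans h)⟩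
      · exact ⟨false, j, a, _, ha, List.getElem?_eq_getElem hj, hx⟩

end MismatchMachine

/-! ### The reduction is computable -/

section Reduction

open Turing StateTransition MismatchState

theorem primrec_counterTransition {σ : Type*} [Primcodable σ] {f g : σ → ℕ} (hf : Primrec f)
    (hg : Primrec g) (c : ℕ) (pos mv : Bool) (d : ℤ) :
    Primrec fun x => (⟨f x, some c, pos, g x, mv, d⟩ : CounterTransition) := by
  have : Primrec fun x => CounterTransition.equivTuple.symm (f x, some c, pos, g x, mv, d) :=
    Primrec.of_equiv_symm.comp (hf.pair ((Primrec.const _).pair ((Primrec.const _).pair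
      (hg.pair ((Primrec.const _).pair (Primrec.const _))))))
  exact this

theorem primrec_code_emit (i : Bool) : Primrec fun w : List ℕ => (emit i w).code := by
  have : Primrec fun w : List ℕ => Nat.pair 1 (Encodable.encode (i, w)) :=
    Primrec₂.natPair.comp (Primrec.const 1)
      (Primrec.encode.comp ((Primrec.const i).pair Primrec.id))
  exact this

theorem primrec_code_chosen : Primrec fun b : ℕ => (chosen b).code := by
  have : Primrec fun b : ℕ => Nat.pair 2 b := Primrec₂.natPair.comp (Primrec.const 2) Primrec.id
  exact this

theorem primrec_flatMap_const {σ τ : Type*} [Primcodable σ] [Primcodable τ]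
    (l : List τ) {f : σ → τ → List CounterTransition} (hf : ∀ x ∈ l, Primrec fun a => f a x) :
    Primrec fun a => l.flatMap (f a) := by
  induction l with
  | nil => exact Primrec.const []
  | cons x l ih =>
    exact Primrec.list_append.comp (hf x (by simp)) (ih fun y hy => hf y (by simp [hy]))

theorem primrec_countTransitions (k : ℕ) (i : Bool) : Primrec (countTransitions k i) := by
  have hw : Primrec fun x : ℕ × List ℕ => (emit i (x.1 :: x.2)).code :=
    (primrec_code_emit i).comp (Primrec.list_cons.comp Primrec.fst Primrec.snd)
  have hhead : Primrec fun x : ℕ × List ℕ => (readings k).flatMap fun y =>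
      [counterTransition (emit i (x.1 :: x.2)) y.2 y.1 (emit i x.2) false 1,
        counterTransition (emit i (x.1 :: x.2)) y.2 y.1 (chosen x.1) false 0] := by
    refine primrec_flatMap_const _ fun y _ => ?_
    refine Primrec.list_cons.comp ?_ (Primrec.list_cons.comp ?_ (Primrec.const []))
    · exact primrec_counterTransition hw ((primrec_code_emit i).comp Primrec.snd) _ _ _ _
    · exact primrec_counterTransition hw (primrec_code_chosen.comp Primrec.fst) _ _ _ _
  have hrec := Primrec.list_rec (f := fun w : List ℕ => w)
    (g := fun _ => ([] : List CounterTransition))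
    (h := fun _ x => ((readings k).flatMap fun y =>
      [counterTransition (emit i (x.1 :: x.2.1)) y.2 y.1 (emit i x.2.1) false 1,
        counterTransition (emit i (x.1 :: x.2.1)) y.2 y.1 (chosen x.1) false 0]) ++ x.2.2)
    Primrec.id (Primrec.const [])
    (Primrec.list_append.comp
      (hhead.comp ((Primrec.fst.comp Primrec.snd).pair
        (Primrec.fst.comp (Primrec.snd.comp Primrec.snd))))
      (Primrec.snd.comp (Primrec.snd.comp Primrec.snd)))
  refine hrec.of_eq fun w => ?_
  induction w with
  | nil => rfl
  | cons b w ih => exact congrArg _ ih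

/-- Only `p` varies: the transitions of the dominoes form a constant list, so nothing is required of
`h`. -/
theorem primrec_mismatchTransitions (k : ℕ) (h : Bool → ℕ → List ℕ) :
    Primrec (mismatchTransitions k h) := by
  refine Primrec.list_append.comp (Primrec.list_append.comp ?_ (primrec_countTransitions k true))
    (Primrec.const _)
  refine primrec_flatMap_const _ fun y _ => ?_
  refine Primrec.list_cons.comp ?_ (Primrec.list_cons.comp ?_ (Primrec.const []))
  · exact Primrec.const _
  · exact primrec_counterTransition (Primrec.const _) (primrec_code_emit true) _ _ _ _

theorem primrec_transition_src : Primrec CounterTransition.src :=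
  Primrec.fst.comp (Primrec.of_equiv (e := CounterTransition.equivTuple))

theorem primrec_transition_tgt : Primrec CounterTransition.tgt :=
  (Primrec.fst.comp (Primrec.snd.comp (Primrec.snd.comp Primrec.snd))).comp
    (Primrec.of_equiv (e := CounterTransition.equivTuple))

theorem primrec_mismatchMachine (k : ℕ) (h : Bool → ℕ → List ℕ) :
    Primrec (mismatchMachine k h) := by
  have ht := primrec_mismatchTransitions k h
  have hnum : Primrec fun p => (mismatchTransitions k h p).foldr
      (fun t n => max (max t.src t.tgt) n) accept.code + 1 := by
    refine Primrec.succ.comp (Primrec.list_foldr (h := fun _ x => max (max x.1.src x.1.tgt) x.2)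
      ht (Primrec.const _) ?_)
    have hfst : Primrec fun x : List ℕ × CounterTransition × ℕ => x.2.1 :=
      Primrec.fst.comp Primrec.snd
    exact Primrec.nat_max.comp (Primrec.nat_max.comp (primrec_transition_src.comp hfst)
      (primrec_transition_tgt.comp hfst)) (Primrec.snd.comp Primrec.snd)
  have : Primrec fun p => CounterMachine.equivTuple.symm
      ((mismatchTransitions k h p).foldr (fun t n => max (max t.src t.tgt) n) accept.code + 1, k,
        mismatchTransitions k h p, start.code, [accept.code]) :=
    Primrec.of_equiv_symm.comp (hnum.pair ((Primrec.const _).pair (ht.pair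
      ((Primrec.const _).pair (Primrec.const _)))))
  exact this

/-! ### Dominoes as letters -/

theorem finite_dominoes {Γ Λ : Type*} [Inhabited Γ] [Inhabited Λ] [Finite Γ] [Finite Λ]
    (M : TM0.Machine Γ Λ) : {d | IsDomino (TMRule M) .halt .hash d}.Finite := by
  have hfin := List.finite_length_le (TMSym Γ Λ) 3
  refine (hfin.prod hfin).subset ?_
  rintro ⟨l, r⟩ (hd | ⟨a, hd⟩ | hd)
  · exact hd.length_le
  · simp_all
  · simp_all

variable {α : Type*}

/-- The `i`-th row of the `a`-th domino of a list, where the dominoes are numbered from `1`, as a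
word of natural numbers. -/
def rowOfLetter (D : List (List α × List α)) (enc : α → ℕ) (i : Bool) (a : ℕ) : List ℕ :=
  ((D[a - 1]?).elim [] fun d => bif i then d.2 else d.1).map enc

/-- Numbers beyond the list of dominoes have empty rows; `filterMap` drops them. -/
theorem flatMap_rowOfLetter (D : List (List α × List α)) (enc : α → ℕ) (i : Bool) (l : List ℕ) :
    l.flatMap (rowOfLetter D enc i) = ((l.filterMap fun a => D[a - 1]?).flatMap
      fun d => bif i then d.2 else d.1).map enc := by
  induction l with
  | nil => rfl
  | cons a l ih =>
    rw [List.flatMap_cons, ih, rowOfLetter]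
    cases h : D[a - 1]? <;> simp [h]

theorem exists_letters {D ds : List (List α × List α)} (h : ds ⊆ D) :
    ∃ l : List ℕ, (∀ a ∈ l, 0 < a ∧ a < D.length + 1) ∧ (l.filterMap fun a => D[a - 1]?) = ds := by
  induction ds with
  | nil => exact ⟨[], by simp, rfl⟩
  | cons d ds ih =>
    obtain ⟨l, hl, hds⟩ := ih fun x hx => h (by simp [hx])
    obtain ⟨j, hj⟩ := List.mem_iff_getElem?.1 (h (List.mem_cons_self (a := d)))
    have hlt := (List.getElem?_eq_some_iff.1 hj).1
    exact ⟨(j + 1) :: l, by simpa [hlt] using hl, by simp [hj, hds]⟩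

/-- A domino problem over finitely many symbols, in terms of natural numbers as letters. -/
theorem exists_letters_iff {D : List (List α × List α)} {enc : α → ℕ}
    (henc : Function.Injective enc) {k : ℕ} (hk : D.length + 1 ≤ k) (w : List α) :
    (∃ l : List ℕ, (∀ a ∈ l, 0 < a ∧ a < k) ∧ l.flatMap (rowOfLetter D enc false) =
      w.map enc ++ l.flatMap (rowOfLetter D enc true)) ↔
    ∃ ds, ds ⊆ D ∧ ds.flatMap Prod.fst = w ++ ds.flatMap Prod.snd := by
  have hrow : ∀ l : List ℕ, l.flatMap (rowOfLetter D enc false) =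
      w.map enc ++ l.flatMap (rowOfLetter D enc true) ↔
      (l.filterMap fun a => D[a - 1]?).flatMap Prod.fst =
        w ++ (l.filterMap fun a => D[a - 1]?).flatMap Prod.snd := by
    intro l
    rw [flatMap_rowOfLetter, flatMap_rowOfLetter, ← List.map_append,
      (List.map_injective_iff.2 henc).eq_iff]
    rfl
  constructor
  · rintro ⟨l, -, hl⟩
    refine ⟨l.filterMap fun a => D[a - 1]?, ?_, (hrow l).1 hl⟩
    intro d hd
    obtain ⟨a, -, ha⟩ := List.mem_filterMap.1 hd
    exact List.mem_of_getElem? ha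
  · rintro ⟨ds, hds, heq⟩
    obtain ⟨l, hl, rfl⟩ := exists_letters hds
    exact ⟨l, fun a ha => ⟨(hl a ha).1, (hl a ha).2.trans_le hk⟩, (hrow l).2 heq⟩

/-- There is a computable sequence of machines of the class such that the language of the `n`-th
machine is prefix-dense if and only if the `n`-th program does not halt on `0`. -/
theorem exists_reduction : ∃ F : ℕ → CounterMachine, Primrec F ∧
    (∀ n, (F n).IsNCMOne 1) ∧ ∀ n, PrefixDense (F n).language ↔
      ¬ (Nat.Partrec.Code.eval (Denumerable.ofNat Nat.Partrec.Code n) 0).Dom := by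
  obtain ⟨Γ, Λ, _, _, _, _, M, inp, hinp, hM⟩ := exists_universal_machine
  -- The shift keeps `0` free as the separator.
  let enc : TMSym Γ Λ → ℕ := fun s => (Finite.equivFin _ s : ℕ) + 1
  have henc : Function.Injective enc := fun s t hst =>
    (Finite.equivFin (TMSym Γ Λ)).injective (Fin.ext (Nat.succ_injective hst))
  have hfin := finite_dominoes M
  let D := hfin.toFinset.toList
  have hD : ∀ d, d ∈ D ↔ IsDomino (TMRule M) .halt .hash d := by simp [D]
  -- The same letters name symbols in `z` and dominoes in `α`, so the alphabet must hold both.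
  let k := max (Nat.card (TMSym Γ Λ)) D.length + 1
  have henck : ∀ s, 0 < enc s ∧ enc s < k := by
    intro s
    have := (Finite.equivFin (TMSym Γ Λ) s).2
    simp only [enc, k]
    omega
  let word : ℕ → List (TMSym Γ Λ) := fun n => tmWord default [] (inp n) ++ [.hash]
  have hl : ∀ n, DominoLetters k (rowOfLetter D enc) ((word n).map enc) := by
    intro n
    refine ⟨by simp [k], fun i a x hx => ?_, fun x hx => ?_⟩
    all_goals
      obtain ⟨s, -, rfl⟩ := List.mem_map.1 hx
      exact henck s
  refine ⟨fun n => mismatchMachine k (rowOfLetter D enc) ((word n).map enc), ?_,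
    fun n => mismatchMachine_isNCMOne, fun n => ?_⟩
  · refine (primrec_mismatchMachine _ _).comp ?_
    have hword : ∀ n, enc .leftEnd :: enc (.state default) :: ((inp n).map (enc ∘ .tape) ++
        [enc .rightEnd, enc .hash]) = (word n).map enc := by
      intro n
      simp [word, tmWord]
    refine Primrec.of_eq ?_ hword
    exact Primrec.list_cons.comp (Primrec.const _) (Primrec.list_cons.comp (Primrec.const _)
      (Primrec.list_append.comp (hinp _) (Primrec.const _)))
  · rw [prefixDense_mismatchMachine_iff (hl n), not_iff_not,
      exists_letters_iff henc (by simp [k]), ← hM]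
    have hhash : TMSym.hash ∉ tmWord (default : Λ) [] (inp n) := by simp [tmWord]
    constructor
    · rintro ⟨ds, hds, heq⟩
      obtain ⟨w, hw, hhalt⟩ := exists_derivation_of_dominoes (R := TMRule M)
        (fun _ _ h => h.hash_notMem) (by simp) ds (fun d hd => (hD d).1 (hds hd)) _ [] hhash
        (by simp) .refl (by simpa [word] using heq)
      exact dom_of_rewrites_halt hw hhalt
    · intro hdom
      obtain ⟨ds, hds, heq⟩ := exists_dominoes_of_derivation (hash := TMSym.hash)
        (rewrites_halt_of_dom hdom)
      exact ⟨ds, fun d hd => (hD d).2 (hds d hd), by simpa [word] using heq⟩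

end Reduction

theorem corollary4 :
    ¬ DecidableOn (CounterMachine.IsNCMOne 1)
        (fun M : CounterMachine => PrefixDense M.language) := by
  classical
  rintro ⟨f, hf, hdec⟩
  obtain ⟨F, hF, hclass, hdense⟩ := exists_reduction
  -- The presumed algorithm answers only on machines of the class, but every `F n` is one, so its
  -- composition with `F` is total.
  have hcomp : Computable fun c : Nat.Partrec.Code =>
      decide (PrefixDense (F (Encodable.encode c)).language) := by
    refine Partrec.of_eq_tot (f := fun c => f (F (Encodable.encode c)))
      (hf.comp (hF.comp Primrec.encode).to_comp) fun c => ?_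
    by_cases h : PrefixDense (F (Encodable.encode c)).language
    · simpa [h] using (hdec _ (hclass _)).1 h
    · simpa [h] using (hdec _ (hclass _)).2 h
  have hpred : ComputablePred fun c : Nat.Partrec.Code => ¬ (c.eval 0).Dom := by
    refine ComputablePred.computable_iff.2 ⟨_, hcomp, ?_⟩
    funext c
    simp [hdense]
  exact ComputablePred.halting_problem 0 (hpred.not.of_eq fun c => not_not)
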